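/- Let $n\ge 1$ and $r\ge 1$, let $\mathbb{S}^1=\mathbb{R}/\mathbb{Z}$ and $\mathbb{T}^{2n}=(\mathbb{R}/\mathbb{Z})^{2n}$. Let $f:\mathbb{T}^{2n}\to\mathbb{T}^{2n}$ be an Anosov $C^r$ diffeomorphism that is symplectic, i.e. $f^*\omega=\omega$ for some smooth closed nondegenerate $2$-form $\omega$ on $\mathbb{T}^{2n}$, and let $\gamma\in C^r(\mathbb{T}^{2n};\mathbb{S}^1)$ be a coboundary relative to $f$, i.e. $\gamma=\mu\circ f-\mu$ for some continuous $\mu:\mathbb{T}^{2n}\to\mathbb{S}^1$. Then the skew-product $$F:\mathbb{T}^{2n}\times\mathbb{S}^1\to\mathbb{T}^{2n}\times\mathbb{S}^1,\qquad F(p,t)=(f(p),\,t+\gamma(p)),$$ is not a partially hyperbolic contact diffeomorphism; that is, $F$ is not both partially hyperbolic and a contact diffeomorphism. Here $F$ is a contact diffeomorphism if there are a $1$-form $\alpha$ of class $C^1$ on $\mathbb{T}^{2n}\times\mathbb{S}^1$ with $\alpha\wedge(d\alpha)^n\neq 0$ at every point and a function $\tau:\mathbb{T}^{2n}\times\mathbb{S}^1\to(0,\infty)$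 with $F^*\alpha=\tau\alpha$ (in particular this includes smooth $\alpha$ and $\tau$). A diffeomorphism $F$ of a closed manifold $M$ is partially hyperbolic if, for some Riemannian metric, there is a $DF$-invariant splitting $TM=E^s\oplus E^c\oplus E^u$ such that (i) for some $C>0$ and $0<\lambda<1$, $\|DF^k_p v\|\le C\lambda^k\|v\|$ and $\|DF^{-k}_p w\|\le C\lambda^k\|w\|$ for all $p\in M$, $v\in E^s_p$, $w\in E^u_p$ and $k\ge 0$; and (ii) for every $p\in M$ there are numbers $0<m_1<1<m_2$ with $$\|DF_p|_{E^s_p}\|<m_1<\|DF_p|_{E^c_p}\|<m_2<\|DF_p|_{E^u_p}\|.$$ -/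

import Mathlib

open scoped ContDiff

noncomputable section

/-- The torus `𝕋ᵐ = (ℝ/ℤ)ᵐ`. -/
abbrev Torus (m : ℕ) : Type := Fin m → UnitAddCircle

/-- A torus `M` with its quotient homomorphism `proj : V → M` from a vector space, and a section
`rep` of it. The maps `v ↦ p + proj v` are the inverses of the charts of `M`, and they identify
every tangent space of `M` with `V`. The three instances below (circle, powers, products) are the
only ones used. -/
class FlatTorus (M : Type) (V : outParam Type) [AddCommGroup M] [NormedAddCommGroup V]
    [NormedSpace ℝ V] where
  /-- the quotient homomorphism -/
  proj : V →+ M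
  /-- a choice of representatives -/
  rep : M → V
  proj_rep : ∀ z : M, proj (rep z) = z

/-- The circle `ℝ/ℤ`; representatives are taken in `(-1/2, 1/2]`. -/
instance instFlatTorusCircle : FlatTorus UnitAddCircle ℝ where
  proj := QuotientAddGroup.mk' (AddSubgroup.zmultiples (1 : ℝ))
  rep := fun z => (AddCircle.equivIoc (1 : ℝ) (-1 / 2) z : ℝ)
  proj_rep := fun z => (AddCircle.equivIoc (1 : ℝ) (-1 / 2)).symm_apply_apply z

/-- The torus `(ℝ/ℤ)ᵐ`, with coordinatewise quotient map and representatives. -/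
instance instFlatTorusPi (m : ℕ) : FlatTorus (Torus m) (Fin m → ℝ) where
  proj :=
    { toFun := fun v i => FlatTorus.proj (v i)
      map_zero' := by funext i; simp
      map_add' := by intro u v; funext i; simp }
  rep := fun z i => FlatTorus.rep (z i)
  proj_rep := fun z => funext fun i => FlatTorus.proj_rep (z i)

/-- The product of two tori. -/
instance instFlatTorusProd (M N V W : Type) [AddCommGroup M] [AddCommGroup N]
    [NormedAddCommGroup V] [NormedSpace ℝ V] [NormedAddCommGroup W] [NormedSpace ℝ W]
    [FlatTorus M V] [FlatTorus N W] : FlatTorus (M × N) (V × W) where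
  proj := AddMonoidHom.prodMap FlatTorus.proj FlatTorus.proj
  rep := fun z => (FlatTorus.rep z.1, FlatTorus.rep z.2)
  proj_rep := fun z => Prod.ext (FlatTorus.proj_rep z.1) (FlatTorus.proj_rep z.2)

section Calculus

variable {M N V W : Type} [AddCommGroup M] [AddCommGroup N]
  [NormedAddCommGroup V] [NormedSpace ℝ V] [NormedAddCommGroup W] [NormedSpace ℝ W]
  [FlatTorus M V] [FlatTorus N W]

/-- The expression of `f` in the charts centred at `p` and at `f p`. -/
def localExpr (f : M → N) (p : M) : V → W :=
  fun v => FlatTorus.rep (f (p + FlatTorus.proj v) - f p)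

/-- `f` is of class `C^r`. -/
def IsCr (r : WithTop ℕ∞) (f : M → N) : Prop :=
  ∀ p : M, ContDiffAt ℝ r (localExpr f p) 0

/-- The derivative `Df_p`. -/
def torusDeriv (f : M → N) (p : M) : V →L[ℝ] W :=
  fderiv ℝ (localExpr f p) 0

/-- `f` is a `C^r` diffeomorphism. -/
def IsDiffeo (r : WithTop ℕ∞) (f : M ≃ M) : Prop :=
  IsCr r f ∧ IsCr r f.symm

/-- The exterior derivative of a differential `k`-form `Ω` on `M`, at the point `p`. -/
def formDeriv {k : ℕ} (Ω : M → V [⋀^Fin k]→L[ℝ] ℝ) (p : M) : V [⋀^Fin (k + 1)]→L[ℝ] ℝ :=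
  extDeriv (fun v : V => Ω (p + FlatTorus.proj v)) 0

/-- A differential form is of class `C^r` if its coefficients, read on the universal cover, are. -/
def IsCrForm {k : ℕ} (r : WithTop ℕ∞) (Ω : M → V [⋀^Fin k]→L[ℝ] ℝ) : Prop :=
  ContDiff ℝ r (fun v : V => Ω (FlatTorus.proj v))

/-- The pullback `f^* Ω` of a differential form under a map `f : M → M`. -/
def formPullback {k : ℕ} (f : M → M) (Ω : M → V [⋀^Fin k]→L[ℝ] ℝ) (p : M) :
    V [⋀^Fin k]→L[ℝ] ℝ :=
  (Ω (f p)).compContinuousLinearMap (torusDeriv f p)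

/-- `f` is symplectic: it preserves a symplectic form, that is, a smooth closed nondegenerate
`2`-form. -/
def IsSymplecticMap (f : M → M) : Prop :=
  ∃ Ω : M → V [⋀^Fin 2]→L[ℝ] ℝ,
    IsCrForm ∞ Ω ∧
    (∀ p, formDeriv Ω p = 0) ∧
    (∀ p, ∀ u : V, (∀ v : V, Ω p ![u, v] = 0) → u = 0) ∧
    ∀ p, formPullback f Ω p = Ω p

/-- The `(2n+1)`-form `α ∧ (dα)ⁿ` at `p`, up to the nonzero factor `2ⁿ`, as the full
antisymmetrization of `α ⊗ dα ⊗ ⋯ ⊗ dα`. -/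
def contactVolume (n : ℕ) (α : M → V [⋀^Fin 1]→L[ℝ] ℝ) (p : M) (v : Fin (2 * n + 1) → V) : ℝ :=
  ∑ σ : Equiv.Perm (Fin (2 * n + 1)),
    ((Equiv.Perm.sign σ : ℤ) : ℝ) * (α p ![v (σ 0)] *
      ∏ i : Fin n, formDeriv α p
        ![v (σ ⟨2 * (i : ℕ) + 1, by omega⟩), v (σ ⟨2 * (i : ℕ) + 2, by omega⟩)])

/-- `α` is a contact form (on a torus of dimension `2n+1`) of class `C¹`:
`α ∧ (dα)ⁿ ≠ 0` at every point. -/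
def IsContactForm (n : ℕ) (α : M → V [⋀^Fin 1]→L[ℝ] ℝ) : Prop :=
  IsCrForm 1 α ∧ ∀ p, ∃ v : Fin (2 * n + 1) → V, contactVolume n α p v ≠ 0

/-- `F` is a contact diffeomorphism (on a torus of dimension `2n+1`): `F^* α = τ α` for some
contact form `α` and some positive function `τ`. Neither `α` nor `τ` is required to be smooth,
so that contact diffeomorphisms with smooth `α` and `τ` are included. -/
def IsContactDiffeo (n : ℕ) (F : M ≃ M) : Prop :=
  ∃ (α : M → V [⋀^Fin 1]→L[ℝ] ℝ) (τ : M → ℝ),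
    IsContactForm n α ∧ (∀ p, 0 < τ p) ∧ ∀ p, formPullback F α p = τ p • α p

/-- The family `E` of tangent subspaces is `Df`-invariant: `Df (E_p) = E_{f p}`. -/
def IsInvariantFamily (f : M ≃ M) (E : M → Submodule ℝ V) : Prop :=
  ∀ p, (E p).map (torusDeriv f p : V →ₗ[ℝ] V) = E (f p)

/-- `f` is Anosov. On a compact manifold the choice of norm is immaterial, and the continuity of
the two subbundles follows from the estimates. -/
def IsAnosov (f : M ≃ M) : Prop :=
  ∃ Es Eu : M → Submodule ℝ V,
    (∀ p, IsCompl (Es p) (Eu p)) ∧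
    IsInvariantFamily f Es ∧ IsInvariantFamily f Eu ∧
    ∃ C lam : ℝ, 0 < C ∧ 0 < lam ∧ lam < 1 ∧ ∀ (p : M) (k : ℕ),
      (∀ v ∈ Es p, ‖torusDeriv (f^[k]) p v‖ ≤ C * lam ^ k * ‖v‖) ∧
      (∀ v ∈ Eu p, ‖torusDeriv (f.symm^[k]) p v‖ ≤ C * lam ^ k * ‖v‖)

/-- `g` is a (continuous) Riemannian metric on `M`. -/
def IsRiemannianMetric (g : M → V →L[ℝ] V →L[ℝ] ℝ) : Prop :=
  Continuous (fun v : V => g (FlatTorus.proj v)) ∧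
    (∀ p u v, g p u v = g p v u) ∧ ∀ p v, v ≠ 0 → 0 < g p v v

/-- The norm of a tangent vector at `p`. -/
def metricNorm (g : M → V →L[ℝ] V →L[ℝ] ℝ) (p : M) (v : V) : ℝ :=
  Real.sqrt (g p v v)

/-- The operator norm of the restriction `Df_p : E_p → E_{f p}`. -/
def restrNorm (g : M → V →L[ℝ] V →L[ℝ] ℝ) (f : M → M) (E : M → Submodule ℝ V) (p : M) : ℝ :=
  sSup {c : ℝ | ∃ v ∈ E p, metricNorm g p v ≤ 1 ∧ c = metricNorm g (f p) (torusDeriv f p v)}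

/-- `f` is partially hyperbolic: `TM = Es ⊕ Ec ⊕ Eu` is an invariant splitting, `Es` is uniformly
contracted by `f` and `Eu` by its inverse, and the norms on the three summands are separated by
`m₁ p < 1 < m₂ p`. -/
def IsPartiallyHyperbolic (f : M ≃ M) : Prop :=
  ∃ (g : M → V →L[ℝ] V →L[ℝ] ℝ) (Es Ec Eu : M → Submodule ℝ V),
    IsRiemannianMetric g ∧
    (∀ p, IsCompl (Es p) (Ec p ⊔ Eu p) ∧ Disjoint (Ec p) (Eu p)) ∧
    IsInvariantFamily f Es ∧ IsInvariantFamily f Ec ∧ IsInvariantFamily f Eu ∧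
    (∃ C lam : ℝ, 0 < C ∧ 0 < lam ∧ lam < 1 ∧ ∀ (p : M) (k : ℕ),
      (∀ v ∈ Es p,
        metricNorm g (f^[k] p) (torusDeriv (f^[k]) p v) ≤ C * lam ^ k * metricNorm g p v) ∧
      (∀ v ∈ Eu p,
        metricNorm g (f.symm^[k] p) (torusDeriv (f.symm^[k]) p v)
          ≤ C * lam ^ k * metricNorm g p v)) ∧
    ∃ m₁ m₂ : M → ℝ, ∀ p, 0 < m₁ p ∧ m₁ p < 1 ∧ 1 < m₂ p ∧
      restrNorm g f Es p < m₁ p ∧ m₁ p < restrNorm g f Ec p ∧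
      restrNorm g f Ec p < m₂ p ∧ m₂ p < restrNorm g f Eu p

end Calculus

/-- `γ : X → 𝕊¹` is a coboundary relative to `f`: `γ = μ ∘ f - μ` for a transfer map `μ`.
Only continuity of `μ` is required, so that transfer maps of every class `C^ℓ` are included. -/
def IsCoboundary {X : Type} [TopologicalSpace X] (f : X → X) (γ : X → UnitAddCircle) : Prop :=
  ∃ μ : X → UnitAddCircle, Continuous μ ∧ ∀ p, γ p = μ (f p) - μ p

/-- The skew-product `F(p, t) = (f(p), t + γ(p))`. -/
def skewProduct {X : Type} (f : X ≃ X) (γ : X → UnitAddCircle) :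
    X × UnitAddCircle ≃ X × UnitAddCircle where
  toFun := fun z => (f z.1, z.2 + γ z.1)
  invFun := fun z => (f.symm z.1, z.2 - γ (f.symm z.1))
  left_inv := fun z => by simp
  right_inv := fun z => by simp

end

/-! ### Tori, their charts, and calculus in them -/

open scoped ContDiff

noncomputable section

open Filter Topology MeasureTheory

/-! Suppose `F^* α = τ α`. In the splitting into base and fibre, `DF` is block triangular with an
identity in the fibre, so `det DF = det Df`. All iterates of `f`, forward and backward, preserve one
symplectic form, so by compactness their determinants are uniformly bounded away from zero
(`exists_le_abs_det_of_symplectic`). Pullback by `F` multiplies `α ∧ (dα)ⁿ` by `τⁿ⁺¹`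
(`contactVolume_pullback`); hence the factors `τ_k` of the iterates `F^k` are uniformly bounded away
from zero as well (`exists_le_abs_factor`).

The vertical field `∂_t` is `F`-invariant. If `α(∂_t) = 0` at a point, this persists along the
orbit, so `τ_k α(v) = α(Df^k v)` for horizontal `v`. For stable `v` the right side tends to zero, so
`α(v) = 0`; unstable `v` are treated with the inverse. Then `α` vanishes at the point, which is
impossible. Thus `α = φ (dt + θ)` with `φ ≠ 0`. Invariance gives `θ_z(v) = θ_{F^k z}(Df^k v) +
Dγ_k(v)`, whose last term does not depend on `t`, and contraction again shows that `θ` is constant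
on fibres (`vertical_ne_zero_and_fiberSlope_const`).

So `θ` lives on the base torus and `α ∧ (dα)ⁿ = φⁿ⁺¹ dt ∧ (dθ)ⁿ`. By Stokes `(dθ)ⁿ` has integral
zero, so it vanishes somewhere, a contradiction (`not_isContactForm_of_fiberSlope_const`).

The delicate point is regularity: `F` and `α` are only `C¹` and `τ` is arbitrary.
`curl_pullback_of_comp_eq_zero` compares exterior derivatives on `ker α` without differentiating
`DF` or `τ`, and Stokes for a `C¹` form is reached by mollification. -/

/-- Near the origin `rep` inverts `proj`, and representatives are bounded. -/
class TameTorus (M : Type) {V : Type} [AddCommGroup M] [NormedAddCommGroup V] [NormedSpace ℝ V]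
    [FlatTorus M V] : Prop where
  rep_proj : ∀ᶠ v : V in 𝓝 0, FlatTorus.rep (FlatTorus.proj v : M) = v
  norm_rep_le : ∀ z : M, ‖(FlatTorus.rep z : V)‖ ≤ 1

instance tameTorus_circle : TameTorus UnitAddCircle where
  rep_proj := by
    have h : Set.Ioc (-1 / 2 : ℝ) (-1 / 2 + 1) ∈ 𝓝 (0 : ℝ) :=
      Ioc_mem_nhds (by norm_num) (by norm_num)
    filter_upwards [h] with v hv
    have := (AddCircle.equivIoc (1 : ℝ) (-1 / 2)).apply_symm_apply ⟨v, hv⟩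
    exact congrArg Subtype.val this
  norm_rep_le := fun z => by
    have h : (FlatTorus.rep z : ℝ) ∈ Set.Ioc (-1 / 2 : ℝ) (-1 / 2 + 1) :=
      (AddCircle.equivIoc (1 : ℝ) (-1 / 2) z).2
    rw [Real.norm_eq_abs, abs_le]
    constructor <;> linarith [h.1, h.2]

instance tameTorus_pi (m : ℕ) : TameTorus (Torus m) where
  rep_proj := by
    have h : ∀ i : Fin m, ∀ᶠ v : Fin m → ℝ in 𝓝 0,
        FlatTorus.rep (FlatTorus.proj (v i) : UnitAddCircle) = v i := fun i =>
      ((continuous_apply (A := fun _ : Fin m => ℝ) i).tendsto' 0 0 rfl).eventually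
        (TameTorus.rep_proj (M := UnitAddCircle))
    filter_upwards [eventually_all.2 h] with v hv
    exact funext hv
  norm_rep_le := fun z => (pi_norm_le_iff_of_nonneg zero_le_one).2 fun i =>
    TameTorus.norm_rep_le (z i)

instance tameTorus_prod (M N V W : Type) [AddCommGroup M] [AddCommGroup N]
    [NormedAddCommGroup V] [NormedSpace ℝ V] [NormedAddCommGroup W] [NormedSpace ℝ W]
    [FlatTorus M V] [FlatTorus N W] [TameTorus M] [TameTorus N] : TameTorus (M × N) where
  rep_proj := by
    have h1 : ∀ᶠ v : V × W in 𝓝 0, FlatTorus.rep (FlatTorus.proj v.1 : M) = v.1 :=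
      (continuous_fst.tendsto' 0 0 rfl).eventually TameTorus.rep_proj
    have h2 : ∀ᶠ v : V × W in 𝓝 0, FlatTorus.rep (FlatTorus.proj v.2 : N) = v.2 :=
      (continuous_snd.tendsto' 0 0 rfl).eventually TameTorus.rep_proj
    filter_upwards [h1, h2] with v hv hv'
    exact Prod.ext hv hv'
  norm_rep_le := fun z => max_le (TameTorus.norm_rep_le z.1) (TameTorus.norm_rep_le z.2)

/-- The covector underlying a `1`-form. -/
def covector {M V : Type} [NormedAddCommGroup V] [NormedSpace ℝ V] (α : M → V [⋀^Fin 1]→L[ℝ] ℝ) (p : M) : V →L[ℝ] ℝ :=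
  (ContinuousAlternatingMap.ofSubsingletonLIE (𝕜 := ℝ) (E := V) (F := ℝ) (0 : Fin 1)).symm (α p)

theorem covector_apply {M V : Type} [NormedAddCommGroup V] [NormedSpace ℝ V] (α : M → V [⋀^Fin 1]→L[ℝ] ℝ) (p : M) (v : V) :
    covector α p v = α p ![v] := by
  change α p (fun _ => v) = _
  congr 1
  funext i
  fin_cases i
  rfl

/-- The exterior derivative at `x` of a covector field on a vector space. -/
def curl {V : Type} [NormedAddCommGroup V] [NormedSpace ℝ V] (A : V → V →L[ℝ] ℝ) (x : V) (u v : V) : ℝ :=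
  fderiv ℝ A x u v - fderiv ℝ A x v u

section Calculus

variable {M N V W : Type} [AddCommGroup M] [AddCommGroup N]
  [NormedAddCommGroup V] [NormedSpace ℝ V] [NormedAddCommGroup W] [NormedSpace ℝ W]
  [FlatTorus M V] [FlatTorus N W]

theorem rep_zero [TameTorus M] : FlatTorus.rep (0 : M) = (0 : V) := by
  have := (TameTorus.rep_proj (M := M) (V := V)).self_of_nhds
  rwa [map_zero] at this

theorem localExpr_zero [TameTorus N] (f : M → N) (p : M) : localExpr f p (0 : V) = (0 : W) := by
  simp [localExpr, rep_zero]

theorem add_proj_localExpr (f : M → N) (p : M) (v : V) :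
    f p + FlatTorus.proj (localExpr f p v : W) = f (p + FlatTorus.proj v) := by
  simp [localExpr, FlatTorus.proj_rep]

/-- An identity of functions, not merely of germs at `0`, because `proj ∘ rep` is the identity
everywhere. -/
theorem localExpr_comp {P U : Type} [AddCommGroup P] [NormedAddCommGroup U] [NormedSpace ℝ U]
    [FlatTorus P U] (g : N → P) (f : M → N) (p : M) :
    (localExpr (g ∘ f) p : V → U) = localExpr g (f p) ∘ localExpr f p := by
  funext v
  change FlatTorus.rep (g (f _) - g (f p)) = FlatTorus.rep (g (_ + FlatTorus.proj _) - g (f p))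
  rw [add_proj_localExpr]

theorem IsCr.comp {P U : Type} [AddCommGroup P] [NormedAddCommGroup U] [NormedSpace ℝ U]
    [FlatTorus P U] [TameTorus N] {r : WithTop ℕ∞} {g : N → P} {f : M → N} (hg : IsCr r g)
    (hf : IsCr r f) : IsCr r (g ∘ f) := fun p => by
  rw [localExpr_comp]
  refine ContDiffAt.comp 0 ?_ (hf p)
  rw [localExpr_zero]
  exact hg (f p)

theorem IsCr.of_le {r s : WithTop ℕ∞} {f : M → N} (hf : IsCr r f) (h : s ≤ r) : IsCr s f :=
  fun p => (hf p).of_le h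

theorem localExpr_id_eventuallyEq [TameTorus M] (p : M) : localExpr (id : M → M) p =ᶠ[𝓝 0] id := by
  filter_upwards [TameTorus.rep_proj (M := M) (V := V)] with v hv
  simpa [localExpr] using hv

theorem isCr_id [TameTorus M] {r : WithTop ℕ∞} : IsCr r (id : M → M) := fun p =>
  contDiffAt_id.congr_of_eventuallyEq (localExpr_id_eventuallyEq p)

theorem torusDeriv_id [TameTorus M] (p : M) :
    torusDeriv (id : M → M) p = ContinuousLinearMap.id ℝ V := by
  rw [torusDeriv, (localExpr_id_eventuallyEq p).fderiv_eq, fderiv_id]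

theorem IsCr.hasFDerivAt {f : M → N} (hf : IsCr 1 f) (p : M) :
    HasFDerivAt (localExpr f p : V → W) (torusDeriv f p) 0 :=
  ((hf p).differentiableAt one_ne_zero).hasFDerivAt

theorem torusDeriv_comp {P U : Type} [AddCommGroup P] [NormedAddCommGroup U] [NormedSpace ℝ U]
    [FlatTorus P U] [TameTorus N] {g : N → P} {f : M → N} (hg : IsCr 1 g)
    (hf : IsCr 1 f) (p : M) :
    torusDeriv (g ∘ f) p = (torusDeriv g (f p)).comp (torusDeriv f p) := by
  rw [torusDeriv, localExpr_comp]
  refine HasFDerivAt.fderiv (HasFDerivAt.comp 0 ?_ (hf.hasFDerivAt p))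
  rw [localExpr_zero]
  exact hg.hasFDerivAt (f p)

/-- Charts centred at nearby points differ by translations. This reads the derivatives at all nearby
points in a single chart, as the pullback lemma for exterior derivatives requires. -/
theorem hasFDerivAt_localExpr_eventually [TameTorus N] {f : M → N} (hf : IsCr 1 f) (p : M) :
    ∀ᶠ x : V in 𝓝 0,
      HasFDerivAt (localExpr f p : V → W) (torusDeriv f (p + FlatTorus.proj x)) x := by
  filter_upwards [(hf p).eventually (by simp)] with x hx
  have hd : DifferentiableAt ℝ (localExpr f p : V → W) x := hx.differentiableAt one_ne_zero
  have h0 : Tendsto (fun w : V => (localExpr f p (x + w) : W) - localExpr f p x) (𝓝 0) (𝓝 0) := by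
    have : ContinuousAt (fun w : V => (localExpr f p (x + w) : W) - localExpr f p x) 0 := by
      refine ContinuousAt.sub ?_ continuousAt_const
      exact ContinuousAt.comp (f := fun w : V => x + w) (x := 0) (by simpa using hd.continuousAt)
        (by fun_prop)
    simpa [ContinuousAt] using this
  have h1 : (localExpr f (p + FlatTorus.proj x) : V → W) =ᶠ[𝓝 0]
      fun w => localExpr f p (x + w) - localExpr f p x := by
    filter_upwards [h0.eventually (TameTorus.rep_proj (M := N) (V := W))] with w hw
    rw [← hw, map_sub]
    change FlatTorus.rep _ = _
    congr 1
    rw [add_assoc, ← map_add, ← add_proj_localExpr f p (x + w), ← add_proj_localExpr f p x]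
    abel
  have h2 : HasFDerivAt (fun w : V => (localExpr f p (x + w) : W) - localExpr f p x)
      (fderiv ℝ (localExpr f p : V → W) x) 0 := by
    have h3 : HasFDerivAt (localExpr f p : V → W) (fderiv ℝ (localExpr f p : V → W) x) (x + 0) := by
      simpa using hd.hasFDerivAt
    have := HasFDerivAt.comp (0 : V) h3 ((hasFDerivAt_id (0 : V)).const_add x)
    exact this.sub_const _
  rw [torusDeriv, h1.fderiv_eq, h2.fderiv]
  exact hd.hasFDerivAt

theorem contDiff_covector {α : M → V [⋀^Fin 1]→L[ℝ] ℝ} {r : WithTop ℕ∞} (hα : IsCrForm r α) :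
    ContDiff ℝ r fun x : V => covector α (FlatTorus.proj x) :=
  (ContinuousAlternatingMap.ofSubsingletonLIE (𝕜 := ℝ) (E := V) (F := ℝ)
    (0 : Fin 1)).symm.toContinuousLinearEquiv.contDiff.comp hα

theorem contDiff_covector_add {α : M → V [⋀^Fin 1]→L[ℝ] ℝ} {r : WithTop ℕ∞} (hα : IsCrForm r α)
    (p : M) : ContDiff ℝ r fun x : V => covector α (p + FlatTorus.proj x) := by
  have : (fun x : V => covector α (p + FlatTorus.proj x)) =
      (fun x : V => covector α (FlatTorus.proj x)) ∘ fun x => FlatTorus.rep p + x := by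
    funext x
    simp [FlatTorus.proj_rep]
  rw [this]
  exact (contDiff_covector hα).comp (by fun_prop)

theorem formDeriv_one_apply {α : M → V [⋀^Fin 1]→L[ℝ] ℝ} (hα : IsCrForm 1 α) (p : M) (u v : V) :
    formDeriv α p ![u, v] = curl (fun x : V => covector α (p + FlatTorus.proj x)) 0 u v := by
  have h : DifferentiableAt ℝ (fun x : V => covector α (p + FlatTorus.proj x)) 0 :=
    (contDiff_covector_add hα p).differentiable one_ne_zero 0
  have h' : DifferentiableAt ℝ (fun x : V => α (p + FlatTorus.proj x)) 0 := by
    have := (ContinuousAlternatingMap.ofSubsingletonLIE (𝕜 := ℝ) (E := V) (F := ℝ)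
      (0 : Fin 1)).toContinuousLinearEquiv.differentiableAt.comp (0 : V) h
    refine this.congr_of_eventuallyEq (Eventually.of_forall fun x => ?_)
    simp [covector]
  have hc : ∀ w : V, HasFDerivAt (fun x : V => covector α (p + FlatTorus.proj x) w)
      ((fderiv ℝ (fun x : V => covector α (p + FlatTorus.proj x)) 0).flip w) 0 := fun w =>
    h.hasFDerivAt.clm_apply (hasFDerivAt_const w 0) |>.congr_fderiv (by ext; simp)
  rw [formDeriv, extDeriv_apply h', Fin.sum_univ_two, curl]
  have e1 : (fun x : V => α (p + FlatTorus.proj x) ((0 : Fin 2).removeNth ![u, v])) =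
      fun x : V => covector α (p + FlatTorus.proj x) v := by
    funext x
    rw [covector_apply]
    congr 1
  have e2 : (fun x : V => α (p + FlatTorus.proj x) ((1 : Fin 2).removeNth ![u, v])) =
      fun x : V => covector α (p + FlatTorus.proj x) u := by
    funext x
    rw [covector_apply]
    congr 1
    funext i
    fin_cases i
    rfl
  rw [e1, e2, (hc u).fderiv, (hc v).fderiv]
  simp [sub_eq_add_neg]

end Calculus

/-! ### Exterior derivatives under `C¹` pullback -/

/-- Two covector fields `A`, `B` with `G^* B = τ A` have related exterior derivatives on
the kernel of `A`. Here `G` is only `C¹` and nothing is assumed of `τ`. -/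
theorem curl_pullback_of_comp_eq_zero {E K : Type} [NormedAddCommGroup E] [NormedSpace ℝ E]
    [NormedAddCommGroup K] [NormedSpace ℝ K]
    {A B : E → E →L[ℝ] ℝ} {G : E → E} {G' : E → E →L[ℝ] E} {τ : E → ℝ}
    (hA : DifferentiableAt ℝ A 0) (hB : DifferentiableAt ℝ B 0) (hG0 : G 0 = 0)
    (hG : ∀ᶠ x in 𝓝 0, HasFDerivAt G (G' x) x) (hG' : ContinuousAt G' 0)
    (h : ∀ᶠ x in 𝓝 0, (B (G x)).comp (G' x) = τ x • A x) (hA0 : A 0 ≠ 0)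
    (j : K →L[ℝ] E) (hj : (A 0).comp j = 0) (u v : K) :
    curl B 0 (G' 0 (j u)) (G' 0 (j v)) = τ 0 * curl A 0 (j u) (j v) := by
  obtain ⟨w, hw⟩ : ∃ w, A 0 w ≠ 0 := by
    by_contra! hc
    exact hA0 (ContinuousLinearMap.ext hc)
  have hGc : ContinuousAt G 0 := hG.self_of_nhds.continuousAt
  have hBG : ContinuousAt (fun x => B (G x)) 0 :=
    ContinuousAt.comp (f := G) (by rw [hG0]; exact hB.continuousAt) hGc
  have hAw : ContinuousAt (fun x => A x w) 0 := hA.continuousAt.clm_apply continuousAt_const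
  -- Near `0` the factor is the quotient of `(G^* B)(w)` by `A(w)`, both continuous.
  have hτ : ContinuousAt τ 0 := by
    have hq : ContinuousAt (fun x => B (G x) (G' x w) / A x w) 0 :=
      (hBG.clm_apply (hG'.clm_apply continuousAt_const)).div hAw hw
    refine hq.congr ?_
    filter_upwards [h, hAw.eventually_ne hw] with x hx hx'
    have := congrArg (fun T : E →L[ℝ] ℝ => T w) hx
    simp only [ContinuousLinearMap.comp_apply, smul_apply, smul_eq_mul] at this
    rw [this]
    field_simp
  set A1 := fderiv ℝ A 0 with hA1
  set B1 := fderiv ℝ B 0 with hB1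
  -- the symmetric part of `B` has a quadratic primitive
  set P' : E → E →L[ℝ] ℝ := fun y => B 0 + (1 / 2 : ℝ) • (B1 y + B1.flip y) with hP'
  have hP : ∀ y, HasFDerivAt (fun y => B 0 y + (1 / 2 : ℝ) * B1 y y) (P' y) y := by
    intro y
    have h1 : HasFDerivAt (fun y => B1 y y) (B1 y + B1.flip y) y := by
      refine (B1.hasFDerivAt.clm_apply (hasFDerivAt_id y)).congr_fderiv ?_
      ext z; simp
    exact (B 0).hasFDerivAt.add (h1.const_mul (1 / 2 : ℝ))
  set S : E →L[ℝ] E →L[ℝ] ℝ := (1 / 2 : ℝ) • (B1.flip - B1) with hS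
  have hSa : ∀ y, P' y = (B 0 + B1 y) + S y := by
    intro y
    ext z
    simp [hP', hS]
    ring
  let f' : E → E →L[ℝ] ℝ := fun x => (P' (G x)).comp (G' x)
  have hf : ∀ᶠ x in 𝓝 (0 : E), HasFDerivAt (fun x => B 0 (G x) + (1 / 2 : ℝ) * B1 (G x) (G x))
      (f' x) x := by
    filter_upwards [hG] with x hx
    exact (hP (G x)).comp x hx
  let R : (E →L[ℝ] ℝ) →L[ℝ] (K →L[ℝ] ℝ) :=
    (ContinuousLinearMap.compL ℝ K E ℝ).flip j
  have hR : ∀ (T : E →L[ℝ] ℝ) (k : K), R T k = T (j k) := fun T k => rfl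
  let D : E →L[ℝ] (K →L[ℝ] ℝ) :=
    R.comp (τ 0 • A1) + R.comp (((ContinuousLinearMap.compL ℝ E E ℝ).flip (G' 0)).comp
      (S.comp (G' 0)))
  have hRA0 : R (A 0) = 0 := by
    ext k
    exact congrArg (fun T : K →L[ℝ] ℝ => T k) hj
  have hGd : HasFDerivAt G (G' 0) 0 := hG.self_of_nhds
  -- differentiability of the restricted derivative
  have hfd : HasFDerivAt (fun x => R (f' x)) D 0 := by
    -- The bracket `B 0 + B1 y - B y + S y` is differentiable and vanishes at `y = G 0 = 0`, so its
    -- product with the merely continuous `G'` is still differentiable at `0`. Likewise `R (A x)`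
    -- vanishes at `0`, so continuity of `τ` suffices.
    have hsplit : (fun x => R (f' x)) =ᶠ[𝓝 0] fun x =>
        τ x • R (A x) + R (((ContinuousLinearMap.compL ℝ E E ℝ)
          (B 0 + B1 (G x) - B (G x) + S (G x))) (G' x)) := by
      filter_upwards [h] with x hx
      rw [← map_smul, ← map_add]
      congr 1
      rw [← hx]
      ext z
      simp only [f', hSa, ContinuousLinearMap.compL_apply, ContinuousLinearMap.comp_apply,
        add_apply, sub_apply]
      ring
    refine HasFDerivAt.congr_of_eventuallyEq ?_ hsplit
    -- a continuous factor times a differentiable function vanishing at the point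
    have h1 : HasFDerivAt (fun x => τ x • R (A x)) (R.comp (τ 0 • A1)) 0 := by
      have hRA : HasFDerivAt (fun x => R (A x)) (R.comp A1) 0 :=
        R.hasFDerivAt.comp (0 : E) hA.hasFDerivAt
      have hO : (fun x => R (A x)) =O[𝓝 0] fun x : E => x := by
        have := hRA.isBigO_sub
        simpa [hRA0] using this
      have ho : (fun x => (τ x - τ 0) • R (A x)) =o[𝓝 0] fun x : E => x := by
        have : (fun x => τ x - τ 0) =o[𝓝 0] fun _ : E => (1 : ℝ) := by
          rw [Asymptotics.isLittleO_one_iff]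
          simpa using hτ.sub_const (τ 0)
        simpa using this.smul_isBigO hO
      have h2 : HasFDerivAt (fun x => (τ x - τ 0) • R (A x)) (0 : E →L[ℝ] (K →L[ℝ] ℝ)) 0 := by
        rw [hasFDerivAt_iff_isLittleO_nhds_zero]
        simpa [hRA0] using ho
      have h3 := h2.add (hRA.const_smul (τ 0))
      refine (h3.congr_fderiv ?_).congr_of_eventuallyEq (Eventually.of_forall fun x => ?_)
      · ext; simp
      · change τ x • R (A x) = (τ x - τ 0) • R (A x) + τ 0 • R (A x)
        module
    have h2 : HasFDerivAt (fun x => R (((ContinuousLinearMap.compL ℝ E E ℝ)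
          (B 0 + B1 (G x) - B (G x) + S (G x))) (G' x)))
        (R.comp (((ContinuousLinearMap.compL ℝ E E ℝ).flip (G' 0)).comp (S.comp (G' 0)))) 0 := by
      let Q : E → E →L[ℝ] ℝ := fun y => B 0 + B1 y - B y + S y
      have hQ : HasFDerivAt Q S 0 := by
        have := ((B1.hasFDerivAt (x := (0 : E))).const_add (B 0)).sub hB.hasFDerivAt |>.add
          (S.hasFDerivAt (x := (0 : E)))
        refine this.congr_fderiv ?_
        simp [hB1]
      have hQG : HasFDerivAt (fun x => Q (G x)) (S.comp (G' 0)) 0 :=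
        HasFDerivAt.comp (0 : E) (by rw [hG0]; exact hQ) hGd
      have hQ0 : Q (G 0) = 0 := by simp [Q, hG0]
      have hO : (fun x => Q (G x)) =O[𝓝 0] fun x : E => x := by
        have := hQG.isBigO_sub
        simpa [hQ0] using this
      have ho : (fun x => (Q (G x)).comp (G' x - G' 0)) =o[𝓝 0] fun x : E => x := by
        have hc : (fun x => G' x - G' 0) =o[𝓝 0] fun _ : E => (1 : ℝ) := by
          rw [Asymptotics.isLittleO_one_iff]
          simpa using hG'.sub_const (G' 0)
        have := hO.norm_norm.mul_isLittleO hc.norm_norm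
        refine (Asymptotics.IsBigO.of_bound 1 (Eventually.of_forall fun x => ?_)).trans_isLittleO
          (this.trans_isBigO (Asymptotics.IsBigO.of_bound 1 (Eventually.of_forall fun x => ?_)))
        · simpa using (Q (G x)).opNorm_comp_le (G' x - G' 0)
        · simp
      have h3 : HasFDerivAt (fun x => (Q (G x)).comp (G' x - G' 0))
          (0 : E →L[ℝ] (E →L[ℝ] ℝ)) 0 := by
        rw [hasFDerivAt_iff_isLittleO_nhds_zero]
        simpa using ho
      have h4 : HasFDerivAt (fun x => (Q (G x)).comp (G' 0))
          (((ContinuousLinearMap.compL ℝ E E ℝ).flip (G' 0)).comp (S.comp (G' 0))) 0 :=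
        ((ContinuousLinearMap.compL ℝ E E ℝ).flip (G' 0)).hasFDerivAt.comp (0 : E) hQG
      have h5 := R.hasFDerivAt.comp (0 : E) (h3.add h4)
      refine (h5.congr_fderiv (by simp)).congr_of_eventuallyEq (Eventually.of_forall fun x => ?_)
      change R _ = R _
      congr 1
      ext z
      simp [Q]
    exact h1.add h2
  have hsub0 : Tendsto j (𝓝 0) (𝓝 0) := j.continuous.tendsto' 0 0 (map_zero j)
  have hfK : ∀ᶠ x in 𝓝 (0 : K), HasFDerivAt
      ((fun x => B 0 (G x) + (1 / 2 : ℝ) * B1 (G x) (G x)) ∘ j) (R (f' (j x))) x := by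
    filter_upwards [hsub0.eventually hf] with x hx
    exact hx.comp x j.hasFDerivAt
  have hfdK : HasFDerivAt (fun x : K => R (f' (j x))) (D.comp j) 0 :=
    HasFDerivAt.comp (0 : K) (f := j) (g := fun x => R (f' x)) (by simpa using hfd)
      j.hasFDerivAt
  -- Symmetry of the second derivative of the primitive composed with `G ∘ j`; as `S` is minus half
  -- the exterior derivative of `B`, this is the claim.
  have key := second_derivative_symmetric_of_eventually hfK hfdK u v
  simp [D, hR, hS] at key
  simp only [curl, ← hA1, ← hB1]
  linarith

/-- Restriction to the span of `u` and `v`, parametrized by `ℝ × ℝ`. -/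
theorem curl_pullback_of_ker {E : Type} [NormedAddCommGroup E] [NormedSpace ℝ E]
    {A B : E → E →L[ℝ] ℝ} {G : E → E} {G' : E → E →L[ℝ] E} {τ : E → ℝ}
    (hA : DifferentiableAt ℝ A 0) (hB : DifferentiableAt ℝ B 0) (hG0 : G 0 = 0)
    (hG : ∀ᶠ x in 𝓝 0, HasFDerivAt G (G' x) x) (hG' : ContinuousAt G' 0)
    (h : ∀ᶠ x in 𝓝 0, (B (G x)).comp (G' x) = τ x • A x) (hA0 : A 0 ≠ 0)
    {u v : E} (hu : A 0 u = 0) (hv : A 0 v = 0) :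
    curl B 0 (G' 0 u) (G' 0 v) = τ 0 * curl A 0 u v := by
  let j : ℝ × ℝ →L[ℝ] E := (ContinuousLinearMap.toSpanSingleton ℝ u).coprod
    (ContinuousLinearMap.toSpanSingleton ℝ v)
  have hj : (A 0).comp j = 0 := by
    ext <;> simp [j, hu, hv]
  simpa [j] using curl_pullback_of_comp_eq_zero hA hB hG0 hG hG' h hA0 j hj (1, 0) (0, 1)

/-! ### Linear algebra of the top form `a ∧ dⁿ` -/

section TopForm

variable {E : Type} [AddCommGroup E] [Module ℝ E]

/-- Each index occurs exactly once: `0` in the factor `a`, and `k > 0` in the pair numbered `(k - 1)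
/ 2`, as first or second entry according to parity. -/
theorem tensor_update_linear (n : ℕ) (a : E →ₗ[ℝ] ℝ) (d : E →ₗ[ℝ] E →ₗ[ℝ] ℝ)
    (v : Fin (2 * n + 1) → E) (k : Fin (2 * n + 1)) :
    ∃ l : E →ₗ[ℝ] ℝ, ∀ x, a (Function.update v k x 0) * ∏ i : Fin n,
      d (Function.update v k x ⟨2 * (i : ℕ) + 1, by omega⟩)
        (Function.update v k x ⟨2 * (i : ℕ) + 2, by omega⟩) = l x := by
  by_cases hk : k = 0
  · subst hk
    refine ⟨(∏ i : Fin n, d (v ⟨2 * (i : ℕ) + 1, by omega⟩) (v ⟨2 * (i : ℕ) + 2, by omega⟩)) • a,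
      fun x => ?_⟩
    rw [Function.update_self, LinearMap.smul_apply, smul_eq_mul, mul_comm]
    congr 1
  have hk0 : (k : ℕ) ≠ 0 := fun h => hk (Fin.ext h)
  have hkn : (k : ℕ) < 2 * n + 1 := k.2
  let i₀ : Fin n := ⟨((k : ℕ) - 1) / 2, by omega⟩
  have hne : ∀ i : Fin n, i ≠ i₀ → (2 * (i : ℕ) + 1 ≠ k ∧ 2 * (i : ℕ) + 2 ≠ k) := fun i hi => by
    have : (i : ℕ) ≠ ((k : ℕ) - 1) / 2 := fun h => hi (Fin.ext h)
    omega
  have hupd : ∀ x (j : Fin (2 * n + 1)), (j : ℕ) ≠ k → Function.update v k x j = v j :=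
    fun x j hj => Function.update_of_ne (fun h => hj (congrArg Fin.val h)) _ _
  have hprod : ∀ x, ∏ i ∈ Finset.univ.erase i₀,
      d (Function.update v k x ⟨2 * (i : ℕ) + 1, by omega⟩)
        (Function.update v k x ⟨2 * (i : ℕ) + 2, by omega⟩) = ∏ i ∈ Finset.univ.erase i₀,
      d (v ⟨2 * (i : ℕ) + 1, by omega⟩) (v ⟨2 * (i : ℕ) + 2, by omega⟩) := fun x =>
    Finset.prod_congr rfl fun i hi => by
      have := hne i (Finset.ne_of_mem_erase hi)
      rw [hupd x _ this.1, hupd x _ this.2]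
  set c := a (v 0) * ∏ i ∈ Finset.univ.erase i₀,
      d (v ⟨2 * (i : ℕ) + 1, by omega⟩) (v ⟨2 * (i : ℕ) + 2, by omega⟩) with hc
  have hi₀ : (i₀ : ℕ) = ((k : ℕ) - 1) / 2 := rfl
  rcases Nat.even_or_odd' (k : ℕ) with ⟨j, hj | hj⟩
  · have h2 : (⟨2 * (i₀ : ℕ) + 2, by omega⟩ : Fin (2 * n + 1)) = k := Fin.ext (by simp only; omega)
    refine ⟨c • d (v ⟨2 * (i₀ : ℕ) + 1, by omega⟩), fun x => ?_⟩
    rw [← Finset.mul_prod_erase _ _ (Finset.mem_univ i₀), hprod, h2, Function.update_self,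
      hupd x 0 hk0.symm, hupd x ⟨2 * (i₀ : ℕ) + 1, by omega⟩ (by simp only; omega), LinearMap.smul_apply,
      smul_eq_mul, hc]
    ring
  · have h2 : (⟨2 * (i₀ : ℕ) + 1, by omega⟩ : Fin (2 * n + 1)) = k := Fin.ext (by simp only; omega)
    refine ⟨c • d.flip (v ⟨2 * (i₀ : ℕ) + 2, by omega⟩), fun x => ?_⟩
    rw [← Finset.mul_prod_erase _ _ (Finset.mem_univ i₀), hprod, h2, Function.update_self,
      hupd x 0 hk0.symm, hupd x ⟨2 * (i₀ : ℕ) + 2, by omega⟩ (by simp only; omega), LinearMap.smul_apply,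
      smul_eq_mul, hc, LinearMap.flip_apply]
    ring

/-- The multilinear map `a ⊗ d ⊗ ⋯ ⊗ d`. -/
def tensorForm (n : ℕ) (a : E →ₗ[ℝ] ℝ) (d : E →ₗ[ℝ] E →ₗ[ℝ] ℝ) :
    MultilinearMap ℝ (fun _ : Fin (2 * n + 1) => E) ℝ where
  toFun v := a (v 0) * ∏ i : Fin n,
    d (v ⟨2 * (i : ℕ) + 1, by omega⟩) (v ⟨2 * (i : ℕ) + 2, by omega⟩)
  map_update_add' := fun {inst} v k x y => by
    obtain rfl : inst = instDecidableEqFin _ := Subsingleton.elim _ _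
    obtain ⟨l, hl⟩ := tensor_update_linear n a d v k
    rw [hl, hl, hl, map_add]
  map_update_smul' := fun {inst} v k c x => by
    obtain rfl : inst = instDecidableEqFin _ := Subsingleton.elim _ _
    obtain ⟨l, hl⟩ := tensor_update_linear n a d v k
    rw [hl, hl, map_smul]

/-- The form `a ∧ dⁿ`, up to a nonzero factor. -/
def topForm (n : ℕ) (a : E →ₗ[ℝ] ℝ) (d : E →ₗ[ℝ] E →ₗ[ℝ] ℝ) : E [⋀^Fin (2 * n + 1)]→ₗ[ℝ] ℝ :=
  MultilinearMap.alternatization (tensorForm n a d)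

theorem topForm_apply (n : ℕ) (a : E →ₗ[ℝ] ℝ) (d : E →ₗ[ℝ] E →ₗ[ℝ] ℝ) (v : Fin (2 * n + 1) → E) :
    topForm n a d v = ∑ σ : Equiv.Perm (Fin (2 * n + 1)),
      ((Equiv.Perm.sign σ : ℤ) : ℝ) * (a (v (σ 0)) * ∏ i : Fin n,
        d (v (σ ⟨2 * (i : ℕ) + 1, by omega⟩)) (v (σ ⟨2 * (i : ℕ) + 2, by omega⟩))) := by
  rw [topForm, MultilinearMap.alternatization_apply]
  refine Finset.sum_congr rfl fun σ _ => ?_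
  rw [Units.smul_def, zsmul_eq_mul]
  rfl

theorem topForm_apply_comp (n : ℕ) (a : E →ₗ[ℝ] ℝ) (d : E →ₗ[ℝ] E →ₗ[ℝ] ℝ) (L : E →ₗ[ℝ] E)
    (v : Fin (2 * n + 1) → E) :
    topForm n (a ∘ₗ L) (d.compl₁₂ L L) v = topForm n a d (L ∘ v) := by
  simp only [topForm_apply]
  rfl

/-- In top degree every alternating form is a multiple of the determinant of a basis. -/
theorem topForm_comp_eq_det_mul [FiniteDimensional ℝ E] {n : ℕ}
    (hE : Module.finrank ℝ E = 2 * n + 1) (a : E →ₗ[ℝ] ℝ) (d : E →ₗ[ℝ] E →ₗ[ℝ] ℝ)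
    (L : E →ₗ[ℝ] E) (v : Fin (2 * n + 1) → E) :
    topForm n a d (L ∘ v) = LinearMap.det L * topForm n a d v := by
  let b := Module.finBasisOfFinrankEq ℝ E hE
  rw [AlternatingMap.eq_smul_basis_det b (topForm n a d)]
  simp only [AlternatingMap.smul_apply, Module.Basis.det_comp, smul_eq_mul]
  ring

theorem topForm_basis_ne_zero {n : ℕ} (b : Module.Basis (Fin (2 * n + 1)) ℝ E) (a : E →ₗ[ℝ] ℝ)
    (d : E →ₗ[ℝ] E →ₗ[ℝ] ℝ) (h : ∃ v, topForm n a d v ≠ 0) : topForm n a d b ≠ 0 := by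
  obtain ⟨v, hv⟩ := h
  intro h0
  rw [AlternatingMap.eq_smul_basis_det b (topForm n a d), h0] at hv
  simp at hv

/-- A vector off the kernel of a linear form is completed to a basis by vectors of the kernel. -/
theorem exists_basis_ker {m : ℕ} [FiniteDimensional ℝ E] (hE : Module.finrank ℝ E = m + 1)
    {a : E →ₗ[ℝ] ℝ} {x : E} (hx : a x ≠ 0) :
    ∃ b : Module.Basis (Fin (m + 1)) ℝ E, b 0 = x ∧ ∀ i, i ≠ 0 → a (b i) = 0 := by
  have ha : a ≠ 0 := fun h => hx (by rw [h, LinearMap.zero_apply])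
  have hk : Module.finrank ℝ (LinearMap.ker a) = m := by
    have := LinearMap.finrank_range_add_finrank_ker a
    rw [hE, LinearMap.range_eq_top.2 (LinearMap.surjective ha), finrank_top,
      Module.finrank_self] at this
    omega
  let bk := Module.finBasisOfFinrankEq ℝ (LinearMap.ker a) hk
  refine ⟨Module.Basis.mkFinCons x bk ?_ ?_, ?_, ?_⟩
  · intro c y hy h
    have := congrArg a h
    rw [map_add, LinearMap.mem_ker.1 hy, map_smul, map_zero, add_zero, smul_eq_mul] at this
    exact (mul_eq_zero.1 this).resolve_right hx
  · intro z
    refine ⟨-(a z / a x), ?_⟩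
    rw [LinearMap.mem_ker, map_add, map_smul, smul_eq_mul]
    field_simp
    ring
  · rw [Module.Basis.coe_mkFinCons, Fin.cons_zero]
  · intro i hi
    obtain ⟨j, rfl⟩ := Fin.exists_succ_eq.2 hi
    rw [Module.Basis.coe_mkFinCons, Fin.cons_succ]
    exact (bk j).2

/-- The form `a ∧ dⁿ` depends on `d` only through its restriction to `ker a`. In a basis with all
vectors but the first in `ker a`, a nonzero term must feed the first vector to `a`, so `d` sees only
kernel vectors. One factor `c` comes from `a` and `n` from the copies of `d`. -/
theorem topForm_eq_of_ker [FiniteDimensional ℝ E] {n : ℕ}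
    (hE : Module.finrank ℝ E = 2 * n + 1) {a a' : E →ₗ[ℝ] ℝ} {d d' : E →ₗ[ℝ] E →ₗ[ℝ] ℝ} {c : ℝ}
    (h : a' = c • a) (hd : ∀ u v, a u = 0 → a v = 0 → d' u v = c * d u v)
    (v : Fin (2 * n + 1) → E) : topForm n a' d' v = c ^ (n + 1) * topForm n a d v := by
  by_cases ha : a = 0
  · simp [topForm_apply, h, ha]
  obtain ⟨x, hx⟩ : ∃ x, a x ≠ 0 := by
    by_contra! hc
    exact ha (LinearMap.ext hc)
  obtain ⟨b, -, hb⟩ := exists_basis_ker hE hx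
  rw [AlternatingMap.eq_smul_basis_det b (topForm n a' d'),
    AlternatingMap.eq_smul_basis_det b (topForm n a d)]
  have : topForm n a' d' b = c ^ (n + 1) * topForm n a d b := by
    rw [topForm_apply, topForm_apply, Finset.mul_sum]
    refine Finset.sum_congr rfl fun σ _ => ?_
    by_cases hσ : σ 0 = 0
    · have hk : ∀ i : Fin (2 * n + 1), i ≠ 0 → a (b (σ i)) = 0 := fun i hi =>
        hb _ fun h0 => hi (σ.injective (h0.trans hσ.symm))
      rw [Finset.prod_congr rfl fun (i : Fin n) _ =>
        hd (b (σ ⟨2 * (i : ℕ) + 1, by omega⟩)) (b (σ ⟨2 * (i : ℕ) + 2, by omega⟩))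
          (hk _ (by simp [Fin.ext_iff])) (hk _ (by simp [Fin.ext_iff])), Finset.prod_mul_distrib]
      simp [h]
      ring
    · simp [h, hb _ hσ]
  simp only [AlternatingMap.smul_apply, smul_eq_mul, this]
  ring

end TopForm

/-! ### Determinants of symplectic maps and of shears -/

/-- A linear map preserving two nondegenerate bilinear forms has controlled determinant. -/
theorem det_sq_mul_det_gram {V : Type} [AddCommGroup V] [Module ℝ V] {ι : Type} [Fintype ι]
    [DecidableEq ι] (b : Module.Basis ι ℝ V) (B B' : V →ₗ[ℝ] V →ₗ[ℝ] ℝ) (L : V →ₗ[ℝ] V)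
    (h : ∀ u v, B' (L u) (L v) = B u v) :
    LinearMap.det L ^ 2 * (LinearMap.toMatrix₂ b b B').det = (LinearMap.toMatrix₂ b b B).det := by
  have : B = B'.compl₁₂ L L := by
    ext u v
    exact (h u v).symm
  rw [this, LinearMap.toMatrix₂_compl₁₂ b b b b, Matrix.det_mul, Matrix.det_mul,
    Matrix.det_transpose, LinearMap.det_toMatrix]
  ring

theorem det_gram_ne_zero {V : Type} [AddCommGroup V] [Module ℝ V] {ι : Type} [Fintype ι]
    [DecidableEq ι] (b : Module.Basis ι ℝ V) (B : V →ₗ[ℝ] V →ₗ[ℝ] ℝ)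
    (h : ∀ u, (∀ v, B u v = 0) → u = 0) : (LinearMap.toMatrix₂ b b B).det ≠ 0 := by
  exact (LinearMap.separatingLeft_iff_det_ne_zero b).1 h

/-- The determinant of a map of `V × ℝ` which shears along the second factor. -/
theorem det_shear {V : Type} [AddCommGroup V] [Module ℝ V] [FiniteDimensional ℝ V]
    (T : V × ℝ →ₗ[ℝ] V × ℝ) (L : V →ₗ[ℝ] V) (l : V →ₗ[ℝ] ℝ) (h : ∀ v s, T (v, s) = (L v, s + l v)) :
    LinearMap.det T = LinearMap.det L := by
  let b := Module.finBasis ℝ V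
  let e : Module.Basis Unit ℝ ℝ := Module.Basis.singleton Unit ℝ
  have : LinearMap.toMatrix (b.prod e) (b.prod e) T = Matrix.fromBlocks (LinearMap.toMatrix b b L) 0
      (LinearMap.toMatrix b e l) 1 := by
    ext i j
    rcases i with i | i <;> rcases j with j | j <;>
      simp [LinearMap.toMatrix_apply, h, e]
  rw [← LinearMap.det_toMatrix (b.prod e), this, Matrix.det_fromBlocks_zero₁₂,
    LinearMap.det_toMatrix, Matrix.det_one, mul_one]

theorem update_pair_zero {V : Type} (u v x : V) :
    Function.update (![u, v] : Fin 2 → V) 0 x = ![x, v] := by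
  funext i
  fin_cases i <;> rfl

theorem update_pair_one {V : Type} (u v x : V) :
    Function.update (![u, v] : Fin 2 → V) 1 x = ![u, x] := by
  funext i
  fin_cases i <;> rfl

/-- The bilinear form of a `2`-form. -/
def twoFormBilin {V : Type} [NormedAddCommGroup V] [NormedSpace ℝ V] (η : V [⋀^Fin 2]→L[ℝ] ℝ) :
    V →ₗ[ℝ] V →ₗ[ℝ] ℝ :=
  LinearMap.mk₂ ℝ (fun u v => η ![u, v])
    (fun u u' v => by
      have := η.map_update_add ![u, v] 0 u u'
      rwa [update_pair_zero, update_pair_zero, update_pair_zero] at this)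
    (fun c u v => by
      have := η.map_update_smul ![u, v] 0 c u
      rwa [update_pair_zero, update_pair_zero] at this)
    (fun u v v' => by
      have := η.map_update_add ![u, v] 1 v v'
      rwa [update_pair_one, update_pair_one, update_pair_one] at this)
    (fun c u v => by
      have := η.map_update_smul ![u, v] 1 c v
      rwa [update_pair_one, update_pair_one] at this)

/-! ### Uniform bounds from compactness -/

section Bounds

variable {M V : Type} [AddCommGroup M] [NormedAddCommGroup V] [NormedSpace ℝ V]
  [FlatTorus M V] [TameTorus M] [FiniteDimensional ℝ V]

theorem exists_norm_le_of_continuous {F : Type} [SeminormedAddCommGroup F] {q : M → F}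
    (hq : Continuous fun x : V => q (FlatTorus.proj x)) : ∃ K : ℝ, 0 < K ∧ ∀ z, ‖q z‖ ≤ K := by
  obtain ⟨K, hK⟩ := (isCompact_closedBall (0 : V) 1).exists_bound_of_continuousOn hq.continuousOn
  refine ⟨max K 1, by positivity, fun z => ?_⟩
  have := hK (FlatTorus.rep z) (mem_closedBall_zero_iff.2 (TameTorus.norm_rep_le z))
  rw [FlatTorus.proj_rep] at this
  exact this.trans (le_max_left _ _)

theorem exists_le_abs_of_continuous {q : M → ℝ} (hq : Continuous fun x : V => q (FlatTorus.proj x))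
    (h0 : ∀ z, q z ≠ 0) : ∃ c : ℝ, 0 < c ∧ ∀ z, c ≤ |q z| := by
  obtain ⟨K, hK, h⟩ := exists_norm_le_of_continuous (q := fun z => (q z)⁻¹)
    (hq.inv₀ fun x => h0 _)
  refine ⟨K⁻¹, inv_pos.2 hK, fun z => ?_⟩
  have := h z
  rw [norm_inv] at this
  exact inv_le_of_inv_le₀ (abs_pos.2 (h0 z)) this

/-- The Gram determinant `q` of `Ω` is continuous and nowhere zero, and `(det Df)² q(f p) = q(p)`.
The bound depends on `Ω` alone, so it serves all iterates at once. -/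
theorem exists_le_abs_det_of_symplectic {Ω : M → V [⋀^Fin 2]→L[ℝ] ℝ} (hΩ : IsCrForm ∞ Ω)
    (hnd : ∀ p, ∀ u : V, (∀ v : V, Ω p ![u, v] = 0) → u = 0) :
    ∃ c : ℝ, 0 < c ∧ ∀ f : M → M, (∀ p, formPullback f Ω p = Ω p) →
      ∀ p, c ≤ |LinearMap.det (torusDeriv f p : V →ₗ[ℝ] V)| := by
  let b := Module.finBasis ℝ V
  let q : M → ℝ := fun p => (LinearMap.toMatrix₂ b b (twoFormBilin (Ω p))).det
  have hq : Continuous fun x : V => q (FlatTorus.proj x) := by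
    refine Continuous.matrix_det (continuous_matrix fun i j => ?_)
    simp only [LinearMap.toMatrix₂_apply]
    have h := hΩ.continuous
    exact (ContinuousAlternatingMap.apply ℝ V ℝ ![b i, b j]).continuous.comp h
  have hq0 : ∀ p, q p ≠ 0 := fun p => det_gram_ne_zero b _ (hnd p)
  obtain ⟨K, hK, hKq⟩ := exists_norm_le_of_continuous hq
  obtain ⟨c, hc, hcq⟩ := exists_le_abs_of_continuous hq hq0
  -- The minimum with `1` avoids a square root: if `D < 1` then `D ≥ D² ≥ c / K`.
  refine ⟨min (c / K) 1, by positivity, fun f hf p => ?_⟩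
  have h : LinearMap.det (torusDeriv f p : V →ₗ[ℝ] V) ^ 2 * q (f p) = q p := by
    refine det_sq_mul_det_gram b _ _ _ fun u v => ?_
    have := congrArg (fun T : V [⋀^Fin 2]→L[ℝ] ℝ => T ![u, v]) (hf p)
    refine Eq.trans ?_ this
    change Ω (f p) _ = Ω (f p) (torusDeriv f p ∘ ![u, v])
    congr 1
    funext i
    fin_cases i <;> rfl
  set D := |LinearMap.det (torusDeriv f p : V →ₗ[ℝ] V)| with hD
  have h1 : D ^ 2 * |q (f p)| = |q p| := by
    rw [hD, ← h, abs_mul, abs_pow]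
  have h2 : c / K ≤ D ^ 2 := by
    rw [div_le_iff₀ hK]
    calc c ≤ |q p| := hcq p
      _ = D ^ 2 * |q (f p)| := h1.symm
      _ ≤ D ^ 2 * K := by gcongr; exact hKq _
  by_contra! hlt
  obtain ⟨hl1, hl2⟩ := lt_min_iff.1 hlt
  have : D ^ 2 ≤ D := by nlinarith [abs_nonneg (LinearMap.det (torusDeriv f p : V →ₗ[ℝ] V))]
  linarith

end Bounds

/-! ### The contact volume and its pullback -/

section Curl

variable {E : Type} [NormedAddCommGroup E] [NormedSpace ℝ E]

/-- `curl A x` as a bilinear form. -/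
def curlForm (A : E → E →L[ℝ] ℝ) (x : E) : E →ₗ[ℝ] E →ₗ[ℝ] ℝ :=
  LinearMap.mk₂ ℝ (curl A x)
    (fun u u' v => by simp only [curl, map_add, add_apply]; ring)
    (fun c u v => by simp only [curl, map_smul, smul_apply, smul_eq_mul]; ring)
    (fun u v v' => by simp only [curl, map_add, add_apply]; ring)
    (fun c u v => by simp only [curl, map_smul, smul_apply, smul_eq_mul]; ring)

theorem curlForm_apply (A : E → E →L[ℝ] ℝ) (x u v : E) : curlForm A x u v = curl A x u v := rfl

theorem curl_add_left (A : E → E →L[ℝ] ℝ) (x u v : E) :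
    curl (fun y => A (x + y)) 0 u v = curl A x u v := by
  rw [curl, curl, fderiv_comp_add_left, add_zero]

theorem continuous_curl {A : E → E →L[ℝ] ℝ} (hA : ContDiff ℝ 1 A) (u v : E) :
    Continuous fun x => curl A x u v := by
  have := hA.continuous_fderiv one_ne_zero
  unfold curl
  fun_prop

end Curl

section Contact

variable {M E : Type} [AddCommGroup M] [NormedAddCommGroup E] [NormedSpace ℝ E] [FlatTorus M E]

/-- The linear algebra data of a contact form at a point give its volume form. -/
theorem contactVolume_eq_topForm {n : ℕ} {α : M → E [⋀^Fin 1]→L[ℝ] ℝ} (hα : IsCrForm 1 α) (z : M)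
    (v : Fin (2 * n + 1) → E) :
    contactVolume n α z v = topForm n (covector α z : E →ₗ[ℝ] ℝ)
      (curlForm (fun x : E => covector α (z + FlatTorus.proj x)) 0) v := by
  rw [topForm_apply, contactVolume]
  simp only [formDeriv_one_apply hα, ← covector_apply]
  rfl

theorem IsContactForm.covector_ne_zero {n : ℕ} {α : M → E [⋀^Fin 1]→L[ℝ] ℝ}
    (hα : IsContactForm n α) (z : M) : covector α z ≠ 0 := by
  obtain ⟨v, hv⟩ := hα.2 z
  intro h
  rw [contactVolume_eq_topForm hα.1, h, topForm_apply] at hv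
  simp at hv

theorem continuous_contactVolume {n : ℕ} {α : M → E [⋀^Fin 1]→L[ℝ] ℝ} (hα : IsCrForm 1 α)
    (v : Fin (2 * n + 1) → E) :
    Continuous fun x : E => contactVolume n α (FlatTorus.proj x) v := by
  have hA := contDiff_covector hα
  have : (fun x : E => contactVolume n α (FlatTorus.proj x) v) = fun x =>
      topForm n (covector α (FlatTorus.proj x) : E →ₗ[ℝ] ℝ)
        (curlForm (fun x : E => covector α (FlatTorus.proj x)) x) v := by
    funext x
    rw [contactVolume_eq_topForm hα]
    congr 2
    ext u v
    simp only [curlForm_apply, ← map_add]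
    exact curl_add_left (fun y : E => covector α (FlatTorus.proj y)) x u v
  rw [this]
  simp only [topForm_apply, curlForm_apply]
  refine continuous_finsetSum _ fun σ _ => continuous_const.mul (Continuous.mul ?_
    (continuous_finsetProd _ fun i _ => continuous_curl hA _ _))
  exact hA.continuous.clm_apply continuous_const

theorem covector_pullback {G : M → M} {α : M → E [⋀^Fin 1]→L[ℝ] ℝ} {τ : M → ℝ}
    (h : ∀ z, formPullback G α z = τ z • α z) (z : M) (v : E) :
    covector α (G z) (torusDeriv G z v) = τ z * covector α z v := by
  have := congrArg (fun T : E [⋀^Fin 1]→L[ℝ] ℝ => T ![v]) (h z)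
  rw [covector_apply, covector_apply]
  refine Eq.trans ?_ this
  change α (G z) _ = α (G z) (torusDeriv G z ∘ ![v])
  congr 1
  funext i
  fin_cases i
  rfl

/-- A `C¹` map with `G^* α = τ α` multiplies the volume `α ∧ (dα)ⁿ` by `τⁿ⁺¹`. -/
theorem contactVolume_pullback [TameTorus M] [FiniteDimensional ℝ E] {n : ℕ}
    (hE : Module.finrank ℝ E = 2 * n + 1) {α : M → E [⋀^Fin 1]→L[ℝ] ℝ} (hα : IsContactForm n α)
    {G : M → M} (hG : IsCr 1 G) {τ : M → ℝ} (h : ∀ z, formPullback G α z = τ z • α z) (z : M)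
    (v : Fin (2 * n + 1) → E) :
    LinearMap.det (torusDeriv G z : E →ₗ[ℝ] E) * contactVolume n α (G z) v =
      τ z ^ (n + 1) * contactVolume n α z v := by
  rw [contactVolume_eq_topForm hα.1, contactVolume_eq_topForm hα.1,
    ← topForm_comp_eq_det_mul hE, ← topForm_apply_comp]
  refine topForm_eq_of_ker hE ?_ ?_ v
  · ext u
    exact covector_pullback h z u
  · intro u w hu hw
    have hev := hasFDerivAt_localExpr_eventually hG z
    have hcont : ContinuousAt (fun x : E => torusDeriv G (z + FlatTorus.proj x)) 0 := by
      have h1 : ContinuousAt (fderiv ℝ (localExpr G z : E → E)) 0 :=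
        ((hG z).fderiv_right (m := 0) (by simp)).continuousAt
      exact h1.congr (hev.mono fun x hx => hx.fderiv)
    have key := curl_pullback_of_ker (A := fun x : E => covector α (z + FlatTorus.proj x))
      (B := fun x : E => covector α (G z + FlatTorus.proj x)) (G := localExpr G z)
      (G' := fun x => torusDeriv G (z + FlatTorus.proj x)) (τ := fun x => τ (z + FlatTorus.proj x))
      ((contDiff_covector_add hα.1 z).differentiable one_ne_zero 0)
      ((contDiff_covector_add hα.1 (G z)).differentiable one_ne_zero 0)
      (localExpr_zero G z) hev hcont
      (Eventually.of_forall fun x => by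
        ext y
        simp only [ContinuousLinearMap.comp_apply, smul_apply, smul_eq_mul, add_proj_localExpr]
        exact covector_pullback h _ y)
      (by simpa using hα.covector_ne_zero z) (u := u) (v := w) (by simpa using hu)
      (by simpa using hw)
    simpa [curlForm_apply] using key

end Contact

/-! ### Skew-products and their conformal factors -/

/-- The map `(p, t) ↦ (g p, t + δ p)`. -/
def skewMap {X : Type} (g : X → X) (δ : X → UnitAddCircle) (z : X × UnitAddCircle) :
    X × UnitAddCircle :=
  (g z.1, z.2 + δ z.1)

theorem skewMap_comp {X : Type} (g h : X → X) (δ ε : X → UnitAddCircle) :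
    skewMap g δ ∘ skewMap h ε = skewMap (g ∘ h) (ε + δ ∘ h) := by
  funext z
  simp [skewMap, add_assoc]

section Skew

variable {X V : Type} [AddCommGroup X] [NormedAddCommGroup V] [NormedSpace ℝ V]
  [FlatTorus X V]

theorem isCr_zero {r : WithTop ℕ∞} : IsCr r (0 : X → UnitAddCircle) := fun p => by
  have : (localExpr (0 : X → UnitAddCircle) p : V → ℝ) = fun _ => 0 := by
    funext v
    simp [localExpr, rep_zero]
  rw [this]
  exact contDiffAt_const

theorem IsCr.continuousAt_localExpr {δ : X → UnitAddCircle} (hδ : IsCr 1 δ) (p : X) :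
    Tendsto (localExpr δ p : V → ℝ) (𝓝 0) (𝓝 0) := by
  have := (hδ p).continuousAt
  rwa [ContinuousAt, localExpr_zero] at this

theorem localExpr_add_eventuallyEq {δ ε : X → UnitAddCircle} (hδ : IsCr 1 δ) (hε : IsCr 1 ε)
    (p : X) : (localExpr (δ + ε) p : V → ℝ) =ᶠ[𝓝 0] localExpr δ p + localExpr ε p := by
  have h0 : Tendsto (fun v : V => localExpr δ p v + localExpr ε p v : V → ℝ) (𝓝 0) (𝓝 0) := by
    simpa using (hδ.continuousAt_localExpr p).add (hε.continuousAt_localExpr p)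
  filter_upwards [h0.eventually (TameTorus.rep_proj (M := UnitAddCircle))] with v hv
  refine Eq.trans ?_ hv
  rw [map_add]
  change FlatTorus.rep _ = _
  congr 1
  have h1 := add_proj_localExpr δ p v
  have h2 := add_proj_localExpr ε p v
  simp only [Pi.add_apply, ← h1, ← h2]
  abel

theorem IsCr.add {δ ε : X → UnitAddCircle} (hδ : IsCr 1 δ) (hε : IsCr 1 ε) : IsCr 1 (δ + ε) :=
  fun p => ((hδ p).add (hε p)).congr_of_eventuallyEq (localExpr_add_eventuallyEq hδ hε p)

theorem IsCr.neg {δ : X → UnitAddCircle} (hδ : IsCr 1 δ) : IsCr 1 (-δ) := fun p => by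
  refine (hδ p).neg.congr_of_eventuallyEq ?_
  have h0 : Tendsto (fun v : V => -localExpr δ p v : V → ℝ) (𝓝 0) (𝓝 0) := by
    simpa using (hδ.continuousAt_localExpr p).neg
  filter_upwards [h0.eventually (TameTorus.rep_proj (M := UnitAddCircle))] with v hv
  refine Eq.trans ?_ hv
  rw [map_neg]
  change FlatTorus.rep _ = _
  congr 1
  simp only [Pi.neg_apply, ← add_proj_localExpr δ p v]
  abel

/-- Only a germ identity: away from `0` the fibre sum may leave the interval of representatives. -/
theorem localExpr_skewMap_eventuallyEq (g : X → X) {δ : X → UnitAddCircle} (hδ : IsCr 1 δ)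
    (z : X × UnitAddCircle) : (localExpr (skewMap g δ) z : V × ℝ → V × ℝ) =ᶠ[𝓝 0]
      fun v => (localExpr g z.1 v.1, v.2 + localExpr δ z.1 v.1) := by
  have h0 : Tendsto (fun v : V × ℝ => v.2 + localExpr δ z.1 v.1 : V × ℝ → ℝ) (𝓝 0) (𝓝 0) := by
    have h1 : Tendsto (fun v : V × ℝ => v.2) (𝓝 0) (𝓝 0) := continuous_snd.tendsto' _ _ rfl
    have h2 : Tendsto (fun v : V × ℝ => v.1) (𝓝 0) (𝓝 0) := continuous_fst.tendsto' _ _ rfl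
    simpa using h1.add ((hδ.continuousAt_localExpr z.1).comp h2)
  filter_upwards [h0.eventually (TameTorus.rep_proj (M := UnitAddCircle))] with v hv
  refine Prod.ext rfl (Eq.trans ?_ hv)
  rw [map_add]
  change FlatTorus.rep (z.2 + FlatTorus.proj v.2 + δ (z.1 + FlatTorus.proj v.1) - (z.2 + δ z.1)) = _
  rw [← add_proj_localExpr δ z.1 v.1]
  congr 1
  abel

theorem IsCr.skewMap {g : X → X} (hg : IsCr 1 g) {δ : X → UnitAddCircle} (hδ : IsCr 1 δ) :
    IsCr 1 (skewMap g δ) := fun z => by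
  refine ContDiffAt.congr_of_eventuallyEq ?_ (localExpr_skewMap_eventuallyEq g hδ z)
  have h1 : ContDiffAt ℝ 1 (localExpr g z.1 ∘ Prod.fst : V × ℝ → V) 0 :=
    ContDiffAt.comp (0 : V × ℝ) (hg z.1) contDiffAt_fst
  have h2 : ContDiffAt ℝ 1 (localExpr δ z.1 ∘ Prod.fst : V × ℝ → ℝ) 0 :=
    ContDiffAt.comp (0 : V × ℝ) (hδ z.1) contDiffAt_fst
  exact h1.prodMk (contDiffAt_snd.add h2)

theorem torusDeriv_skewMap {g : X → X} (hg : IsCr 1 g) {δ : X → UnitAddCircle} (hδ : IsCr 1 δ)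
    (z : X × UnitAddCircle) (v : V) (s : ℝ) :
    torusDeriv (skewMap g δ) z (v, s) = (torusDeriv g z.1 v, s + torusDeriv δ z.1 v) := by
  have h1 : HasFDerivAt (localExpr g z.1 ∘ Prod.fst : V × ℝ → V)
      ((torusDeriv g z.1).comp (ContinuousLinearMap.fst ℝ V ℝ)) 0 :=
    HasFDerivAt.comp (0 : V × ℝ) (hg.hasFDerivAt z.1) hasFDerivAt_fst
  have h2 : HasFDerivAt (localExpr δ z.1 ∘ Prod.fst : V × ℝ → ℝ)
      ((torusDeriv δ z.1).comp (ContinuousLinearMap.fst ℝ V ℝ)) 0 :=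
    HasFDerivAt.comp (0 : V × ℝ) (hδ.hasFDerivAt z.1) hasFDerivAt_fst
  have h3 := h1.prodMk (hasFDerivAt_snd.add h2)
  rw [torusDeriv, (localExpr_skewMap_eventuallyEq g hδ z).fderiv_eq]
  exact congrArg (fun T : V × ℝ →L[ℝ] V × ℝ => T (v, s)) h3.fderiv

/-- The pairs `(g, δ)` whose skew-product is a `C¹` map preserving the kernel of `α`, over a map
preserving `Ω`. -/
structure IsAdmissible (Ω : X → V [⋀^Fin 2]→L[ℝ] ℝ)
    (α : X × UnitAddCircle → (V × ℝ) [⋀^Fin 1]→L[ℝ] ℝ) (g : X → X) (δ : X → UnitAddCircle) :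
    Prop where
  left : IsCr 1 g
  right : IsCr 1 δ
  symplectic : ∀ p, formPullback g Ω p = Ω p
  contact : ∃ τ : X × UnitAddCircle → ℝ, ∀ z, formPullback (skewMap g δ) α z = τ z • α z

variable [TameTorus X]

theorem formPullback_comp {M U : Type} [AddCommGroup M] [NormedAddCommGroup U] [NormedSpace ℝ U]
    [FlatTorus M U] [TameTorus M] {g h : M → M} (hg : IsCr 1 g) (hh : IsCr 1 h) {k : ℕ}
    (Ω : M → U [⋀^Fin k]→L[ℝ] ℝ) (p : M) :
    formPullback (g ∘ h) Ω p =
      (formPullback g Ω (h p)).compContinuousLinearMap (torusDeriv h p) := by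
  rw [formPullback, torusDeriv_comp hg hh]
  rfl

theorem formPullback_id {M U : Type} [AddCommGroup M] [NormedAddCommGroup U] [NormedSpace ℝ U]
    [FlatTorus M U] [TameTorus M] {k : ℕ} (Ω : M → U [⋀^Fin k]→L[ℝ] ℝ) (p : M) :
    formPullback id Ω p = Ω p := by
  rw [formPullback, torusDeriv_id]
  rfl

theorem IsAdmissible.comp {Ω : X → V [⋀^Fin 2]→L[ℝ] ℝ}
    {α : X × UnitAddCircle → (V × ℝ) [⋀^Fin 1]→L[ℝ] ℝ} {g h : X → X} {δ ε : X → UnitAddCircle}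
    (hg : IsAdmissible Ω α g δ) (hh : IsAdmissible Ω α h ε) :
    IsAdmissible Ω α (g ∘ h) (ε + δ ∘ h) where
  left := hg.left.comp hh.left
  right := hh.right.add (hg.right.comp hh.left)
  symplectic := fun p => by
    rw [formPullback_comp hg.left hh.left, hg.symplectic]
    exact hh.symplectic p
  contact := by
    obtain ⟨τ, hτ⟩ := hg.contact
    obtain ⟨τ', hτ'⟩ := hh.contact
    refine ⟨fun z => τ (skewMap h ε z) * τ' z, fun z => ?_⟩
    rw [← skewMap_comp, formPullback_comp (hg.left.skewMap hg.right) (hh.left.skewMap hh.right), hτ,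
      mul_smul, ← hτ']
    rfl

theorem isAdmissible_id (Ω : X → V [⋀^Fin 2]→L[ℝ] ℝ)
    (α : X × UnitAddCircle → (V × ℝ) [⋀^Fin 1]→L[ℝ] ℝ) : IsAdmissible Ω α id 0 where
  left := isCr_id
  right := isCr_zero
  symplectic := formPullback_id Ω
  contact := by
    refine ⟨fun _ => 1, fun z => ?_⟩
    have : skewMap (id : X → X) 0 = id := by
      funext z
      simp [skewMap]
    rw [this, formPullback_id, one_smul]

theorem IsAdmissible.iterate {Ω : X → V [⋀^Fin 2]→L[ℝ] ℝ}
    {α : X × UnitAddCircle → (V × ℝ) [⋀^Fin 1]→L[ℝ] ℝ} {g : X → X} {δ : X → UnitAddCircle}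
    (hg : IsAdmissible Ω α g δ) (k : ℕ) : ∃ ε, IsAdmissible Ω α (g^[k]) ε := by
  induction k with
  | zero => exact ⟨0, isAdmissible_id Ω α⟩
  | succ k ih =>
    obtain ⟨ε, hε⟩ := ih
    exact ⟨_, hε.comp hg⟩

/-- The inverse of an admissible diffeomorphism is admissible. -/
theorem IsAdmissible.symm {Ω : X → V [⋀^Fin 2]→L[ℝ] ℝ}
    {α : X × UnitAddCircle → (V × ℝ) [⋀^Fin 1]→L[ℝ] ℝ} {f : X ≃ X} {δ : X → UnitAddCircle}
    (hf : IsAdmissible Ω α f δ) (hs : IsCr 1 f.symm)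
    (hτ : ∃ τ : X × UnitAddCircle → ℝ, (∀ z, τ z ≠ 0) ∧
      ∀ z, formPullback (skewMap f δ) α z = τ z • α z) :
    IsAdmissible Ω α f.symm (-(δ ∘ f.symm)) where
  left := hs
  right := (hf.right.comp hs).neg
  symplectic := fun p => by
    have h := formPullback_comp hf.left hs Ω p
    rw [hf.symplectic, Equiv.self_comp_symm, formPullback_id] at h
    exact h.symm
  contact := by
    obtain ⟨τ, hτ0, hτ⟩ := hτ
    have hr : IsCr 1 (-(δ ∘ f.symm)) := (hf.right.comp hs).neg
    set H := skewMap f.symm (-(δ ∘ f.symm)) with hH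
    refine ⟨fun z => (τ (H z))⁻¹, fun z => ?_⟩
    have hid : skewMap f δ ∘ H = id := by
      funext z
      simp [hH, skewMap]
    have h := formPullback_comp (hf.left.skewMap hf.right) (hs.skewMap hr) α z
    rw [← hH, hid, formPullback_id, hτ] at h
    rw [h]
    change formPullback H α z = _ • (τ (H z) • formPullback H α z)
    rw [smul_smul, inv_mul_cancel₀ (hτ0 _), one_smul]

variable [FiniteDimensional ℝ V]

/-- In `det(Dg) vol(G z) = τⁿ⁺¹ vol(z)` the determinant is bounded below and the volume is bounded
on both sides, with constants independent of `g` and `δ`. -/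
theorem exists_le_abs_factor {n : ℕ} (hV : Module.finrank ℝ V = 2 * n)
    {Ω : X → V [⋀^Fin 2]→L[ℝ] ℝ} (hΩ : IsCrForm ∞ Ω)
    (hnd : ∀ p, ∀ u : V, (∀ v : V, Ω p ![u, v] = 0) → u = 0)
    {α : X × UnitAddCircle → (V × ℝ) [⋀^Fin 1]→L[ℝ] ℝ} (hα : IsContactForm n α) :
    ∃ c : ℝ, 0 < c ∧ ∀ g δ, IsAdmissible Ω α g δ → ∀ τ : X × UnitAddCircle → ℝ,
      (∀ z, formPullback (skewMap g δ) α z = τ z • α z) → ∀ z, c ≤ |τ z| := by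
  have hE : Module.finrank ℝ (V × ℝ) = 2 * n + 1 := by
    rw [Module.finrank_prod, hV, Module.finrank_self]
  obtain ⟨c, hc, hdet⟩ := exists_le_abs_det_of_symplectic hΩ hnd
  let b := Module.finBasisOfFinrankEq ℝ (V × ℝ) hE
  have hcont := continuous_contactVolume (n := n) hα.1 b
  have hne : ∀ z, contactVolume n α z b ≠ 0 := fun z => by
    rw [contactVolume_eq_topForm hα.1]
    refine topForm_basis_ne_zero b _ _ ?_
    obtain ⟨v, hv⟩ := hα.2 z
    exact ⟨v, by rwa [contactVolume_eq_topForm hα.1] at hv⟩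
  obtain ⟨K, hK, hKb⟩ := exists_norm_le_of_continuous
    (q := fun z => contactVolume n α z b) hcont
  obtain ⟨m, hm, hmb⟩ := exists_le_abs_of_continuous
    (q := fun z => contactVolume n α z b) hcont hne
  refine ⟨min (c * m / K) 1, by positivity, fun g δ h τ hτ z => ?_⟩
  have key := contactVolume_pullback hE hα (h.left.skewMap h.right) hτ z b
  rw [det_shear _ (torusDeriv g z.1 : V →ₗ[ℝ] V) (torusDeriv δ z.1 : V →ₗ[ℝ] ℝ)
    (fun v s => torusDeriv_skewMap h.left h.right z v s)] at key
  have h1 : c * m / K ≤ |τ z| ^ (n + 1) := by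
    rw [div_le_iff₀ hK]
    calc c * m ≤ |LinearMap.det (torusDeriv g z.1 : V →ₗ[ℝ] V)| *
          |contactVolume n α (skewMap g δ z) b| :=
        mul_le_mul (hdet g h.symplectic z.1) (hmb _) hm.le (abs_nonneg _)
      _ = |τ z| ^ (n + 1) * |contactVolume n α z b| := by rw [← abs_mul, key, abs_mul, abs_pow]
      _ ≤ |τ z| ^ (n + 1) * K := by gcongr; exact hKb z
  by_contra! hlt
  obtain ⟨hl1, hl2⟩ := lt_min_iff.1 hlt
  have : |τ z| ^ (n + 1) ≤ |τ z| := by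
    rw [pow_succ]
    exact mul_le_of_le_one_left (abs_nonneg _) (pow_le_one₀ (abs_nonneg _) hl2.le)
  linarith

theorem nonpos_of_le_geometric {x K lam : ℝ} (h0 : 0 < lam) (h1 : lam < 1)
    (h : ∀ k : ℕ, x ≤ K * lam ^ k) : x ≤ 0 := by
  have : Tendsto (fun k : ℕ => K * lam ^ k) atTop (𝓝 (K * 0)) :=
    (tendsto_pow_atTop_nhds_zero_of_lt_one h0.le h1).const_mul K
  rw [mul_zero] at this
  exact ge_of_tendsto' this h

end Skew

/-! ### Transversality to the fibres and rotation invariance of the kernel -/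

/-- The value of `α` on the vertical vector field. -/
def vertical {X V : Type} [NormedAddCommGroup V] [NormedSpace ℝ V]
    (α : X × UnitAddCircle → (V × ℝ) [⋀^Fin 1]→L[ℝ] ℝ) (z : X × UnitAddCircle) : ℝ :=
  covector α z (0, 1)

/-- The slope of the plane field `ker α` over the base, when it is transverse to the fibres. -/
def fiberSlope {X V : Type} [NormedAddCommGroup V] [NormedSpace ℝ V]
    (α : X × UnitAddCircle → (V × ℝ) [⋀^Fin 1]→L[ℝ] ℝ) (z : X × UnitAddCircle) : V →L[ℝ] ℝ :=
  (vertical α z)⁻¹ • (covector α z).comp (ContinuousLinearMap.inl ℝ V ℝ)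

theorem covector_split {X V : Type} [NormedAddCommGroup V] [NormedSpace ℝ V]
    (α : X × UnitAddCircle → (V × ℝ) [⋀^Fin 1]→L[ℝ] ℝ) (z : X × UnitAddCircle)
    (v : V) (s : ℝ) : covector α z (v, s) = covector α z (v, 0) + s * vertical α z := by
  have : ((v, s) : V × ℝ) = (v, 0) + s • (0, 1) := by simp
  rw [this, map_add, map_smul, vertical, smul_eq_mul]

section Rigidity

variable {X V : Type} [AddCommGroup X] [NormedAddCommGroup V] [NormedSpace ℝ V]
  [FlatTorus X V]

theorem vertical_skewMap {α : X × UnitAddCircle → (V × ℝ) [⋀^Fin 1]→L[ℝ] ℝ} {g : X → X}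
    {δ : X → UnitAddCircle} (hg : IsCr 1 g) (hδ : IsCr 1 δ) {τ : X × UnitAddCircle → ℝ}
    (hτ : ∀ z, formPullback (skewMap g δ) α z = τ z • α z) (z : X × UnitAddCircle) :
    vertical α (skewMap g δ z) = τ z * vertical α z := by
  have h := covector_pullback hτ z (0, 1)
  rwa [torusDeriv_skewMap hg hδ, map_zero, map_zero, add_zero] at h

theorem covector_skewMap {α : X × UnitAddCircle → (V × ℝ) [⋀^Fin 1]→L[ℝ] ℝ} {g : X → X}
    {δ : X → UnitAddCircle} (hg : IsCr 1 g) (hδ : IsCr 1 δ) {τ : X × UnitAddCircle → ℝ}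
    (hτ : ∀ z, formPullback (skewMap g δ) α z = τ z • α z) (z : X × UnitAddCircle) (v : V) :
    covector α (skewMap g δ z) (torusDeriv g z.1 v, 0) +
      torusDeriv δ z.1 v * vertical α (skewMap g δ z) = τ z * covector α z (v, 0) := by
  have h := covector_pullback hτ z (v, 0)
  rwa [torusDeriv_skewMap hg hδ, zero_add, covector_split] at h

theorem contDiff_vertical {α : X × UnitAddCircle → (V × ℝ) [⋀^Fin 1]→L[ℝ] ℝ}
    (hα : IsCrForm 1 α) : ContDiff ℝ 1 fun x : V × ℝ => vertical α (FlatTorus.proj x) :=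
  (contDiff_covector hα).clm_apply contDiff_const

theorem contDiff_fiberSlope {α : X × UnitAddCircle → (V × ℝ) [⋀^Fin 1]→L[ℝ] ℝ}
    (hα : IsCrForm 1 α) (h : ∀ z, vertical α z ≠ 0) :
    ContDiff ℝ 1 fun x : V × ℝ => fiberSlope α (FlatTorus.proj x) :=
  ((contDiff_vertical hα).inv fun _ => h _).smul
    ((contDiff_covector hα).clm_comp contDiff_const)

variable [TameTorus X] [FiniteDimensional ℝ V]

/-- Over a point where `α` kills the vertical direction, it kills every direction contracted by
admissible maps. -/
theorem covector_eq_zero_of_contracted {n : ℕ} (hV : Module.finrank ℝ V = 2 * n)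
    {Ω : X → V [⋀^Fin 2]→L[ℝ] ℝ} (hΩ : IsCrForm ∞ Ω)
    (hnd : ∀ p, ∀ u : V, (∀ v : V, Ω p ![u, v] = 0) → u = 0)
    {α : X × UnitAddCircle → (V × ℝ) [⋀^Fin 1]→L[ℝ] ℝ} (hα : IsContactForm n α)
    {g : X → X} (hg : ∀ k : ℕ, ∃ ε, IsAdmissible Ω α (g^[k]) ε) {C lam : ℝ} (h0 : 0 < lam)
    (h1 : lam < 1) {z : X × UnitAddCircle} {v : V}
    (hv : ∀ k : ℕ, ‖torusDeriv (g^[k]) z.1 v‖ ≤ C * lam ^ k * ‖v‖) (hz : vertical α z = 0) :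
    covector α z (v, 0) = 0 := by
  obtain ⟨c, hc, hfac⟩ := exists_le_abs_factor hV hΩ hnd hα
  obtain ⟨K, hK, hKα⟩ := exists_norm_le_of_continuous (contDiff_covector hα.1).continuous
  have : c * |covector α z (v, 0)| ≤ 0 := by
    refine nonpos_of_le_geometric (K := K * (C * ‖v‖)) h0 h1 fun k => ?_
    obtain ⟨ε, hε⟩ := hg k
    obtain ⟨τ, hτ⟩ := hε.contact
    have e1 := vertical_skewMap hε.left hε.right hτ z
    rw [hz, mul_zero] at e1
    have e2 := covector_skewMap hε.left hε.right hτ z v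
    rw [e1, mul_zero, add_zero] at e2
    calc c * |covector α z (v, 0)| ≤ |τ z| * |covector α z (v, 0)| := by
          gcongr; exact hfac _ _ hε τ hτ z
      _ = |covector α (skewMap (g^[k]) ε z) (torusDeriv (g^[k]) z.1 v, 0)| := by
          rw [e2, abs_mul]
      _ ≤ K * ‖((torusDeriv (g^[k]) z.1 v, 0) : V × ℝ)‖ :=
          ContinuousLinearMap.le_of_opNorm_le _ (hKα _) _
      _ ≤ K * (C * lam ^ k * ‖v‖) := by
          gcongr
          simpa using hv k
      _ = K * (C * ‖v‖) * lam ^ k := by ring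
  have h2 : |covector α z (v, 0)| ≤ 0 := nonpos_of_mul_nonpos_right this hc
  exact abs_eq_zero.1 (le_antisymm h2 (abs_nonneg _))

/-- Along directions contracted by admissible maps the slope is constant on fibres. -/
theorem fiberSlope_eq_of_contracted {Ω : X → V [⋀^Fin 2]→L[ℝ] ℝ}
    {α : X × UnitAddCircle → (V × ℝ) [⋀^Fin 1]→L[ℝ] ℝ} (hα : IsCrForm 1 α)
    (hvert : ∀ z, vertical α z ≠ 0)
    {g : X → X} (hg : ∀ k : ℕ, ∃ ε, IsAdmissible Ω α (g^[k]) ε) {C lam : ℝ} (h0 : 0 < lam)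
    (h1 : lam < 1) {p : X} {v : V}
    (hv : ∀ k : ℕ, ‖torusDeriv (g^[k]) p v‖ ≤ C * lam ^ k * ‖v‖) (t t' : UnitAddCircle) :
    fiberSlope α (p, t) v = fiberSlope α (p, t') v := by
  obtain ⟨K, hK, hKα⟩ := exists_norm_le_of_continuous (contDiff_fiberSlope hα hvert).continuous
  have : |fiberSlope α (p, t) v - fiberSlope α (p, t') v| ≤ 0 := by
    refine nonpos_of_le_geometric (K := 2 * K * (C * ‖v‖)) h0 h1 fun k => ?_
    obtain ⟨ε, hε⟩ := hg k
    obtain ⟨τ, hτ⟩ := hε.contact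
    have e : ∀ t, fiberSlope α (p, t) v =
        fiberSlope α (skewMap (g^[k]) ε (p, t)) (torusDeriv (g^[k]) p v) + torusDeriv ε p v := fun t => by
      have e1 := vertical_skewMap hε.left hε.right hτ (p, t)
      have e2 := covector_skewMap hε.left hε.right hτ (p, t) v
      have hn := hvert (skewMap (g^[k]) ε (p, t))
      have hτ0 : τ (p, t) ≠ 0 := fun h => hn (by rw [e1, h, zero_mul])
      have hn' := hvert (p, t)
      simp only [fiberSlope, smul_apply, ContinuousLinearMap.comp_apply,
        ContinuousLinearMap.inl_apply, smul_eq_mul]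
      simp only at e2
      field_simp
      rw [e1] at e2 ⊢
      linear_combination -vertical α (p, t) * e2
    have hb : ∀ t, |fiberSlope α (skewMap (g^[k]) ε (p, t)) (torusDeriv (g^[k]) p v)| ≤
        K * (C * lam ^ k * ‖v‖) := fun t =>
      (ContinuousLinearMap.le_of_opNorm_le _ (hKα _) _).trans (by gcongr; exact hv k)
    -- The cocycle term `torusDeriv ε p v` depends on the base point only, so it cancels.
    rw [e t, e t', add_sub_add_right_eq_sub]
    refine (abs_sub _ _).trans ?_
    linarith [hb t, hb t']
  linarith [abs_eq_zero.1 (le_antisymm this (abs_nonneg _))]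

/-- A contact form invariant up to a factor under the skew-product of a symplectic Anosov
diffeomorphism is transverse to the fibres, and its kernel is invariant under the vertical
translations. -/
theorem vertical_ne_zero_and_fiberSlope_const {n : ℕ} (hV : Module.finrank ℝ V = 2 * n)
    {f : X ≃ X} (hf : IsCr 1 f) (hf' : IsCr 1 f.symm) (hA : IsAnosov f) (hS : IsSymplecticMap f)
    {γ : X → UnitAddCircle} (hγ : IsCr 1 γ)
    {α : X × UnitAddCircle → (V × ℝ) [⋀^Fin 1]→L[ℝ] ℝ} (hα : IsContactForm n α)
    {τ : X × UnitAddCircle → ℝ} (hτ0 : ∀ z, 0 < τ z)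
    (hτ : ∀ z, formPullback (skewProduct f γ) α z = τ z • α z) :
    (∀ z, vertical α z ≠ 0) ∧ ∀ p t t', fiberSlope α (p, t) = fiberSlope α (p, t') := by
  obtain ⟨Ω, hΩ, -, hnd, hpull⟩ := hS
  obtain ⟨Es, Eu, hcompl, -, -, C, lam, -, h0, h1, hest⟩ := hA
  have hadm : IsAdmissible Ω α f γ := ⟨hf, hγ, hpull, τ, hτ⟩
  have hadm' := hadm.symm hf' ⟨τ, fun z => (hτ0 z).ne', hτ⟩
  have hsplit : ∀ p (v : V), ∃ a ∈ Es p, ∃ b ∈ Eu p, a + b = v := fun p v =>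
    Submodule.mem_sup.1 ((hcompl p).sup_eq_top ▸ Submodule.mem_top)
  have hvert : ∀ z, vertical α z ≠ 0 := by
    intro z hz
    refine hα.covector_ne_zero z (ContinuousLinearMap.ext fun w => ?_)
    obtain ⟨v, s⟩ := w
    obtain ⟨a, ha, b, hb, rfl⟩ := hsplit z.1 v
    have ea := covector_eq_zero_of_contracted hV hΩ hnd hα hadm.iterate h0 h1
      (fun k => (hest z.1 k).1 a ha) hz
    have eb := covector_eq_zero_of_contracted hV hΩ hnd hα hadm'.iterate h0 h1
      (fun k => (hest z.1 k).2 b hb) hz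
    have : ((a + b, 0) : V × ℝ) = (a, 0) + (b, 0) := by simp
    rw [covector_split, hz, this, map_add, ea, eb]
    simp
  refine ⟨hvert, fun p t t' => ContinuousLinearMap.ext fun v => ?_⟩
  obtain ⟨a, ha, b, hb, rfl⟩ := hsplit p v
  rw [map_add, map_add, fiberSlope_eq_of_contracted hα.1 hvert hadm.iterate h0 h1
      (fun k => (hest p k).1 a ha) t t', fiberSlope_eq_of_contracted hα.1 hvert hadm'.iterate h0 h1
      (fun k => (hest p k).2 b hb) t t']

end Rigidity

/-! ### Exactness of the top power of `dθ` -/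

section Antisymmetrization

variable {ι : Type} [Fintype ι] [DecidableEq ι]

theorem sum_sign_mul_swap (Y : Equiv.Perm ι → ℝ) {x y : ι} (h : x ≠ y) :
    ∑ σ : Equiv.Perm ι, ((Equiv.Perm.sign σ : ℤ) : ℝ) * Y (σ * Equiv.swap x y) =
      -∑ σ : Equiv.Perm ι, ((Equiv.Perm.sign σ : ℤ) : ℝ) * Y σ := by
  rw [← Equiv.sum_comp (Equiv.mulRight (Equiv.swap x y))
    (fun σ => ((Equiv.Perm.sign σ : ℤ) : ℝ) * Y σ), ← Finset.sum_neg_distrib]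
  refine Finset.sum_congr rfl fun σ _ => ?_
  simp [Equiv.Perm.sign_swap h]

theorem sum_sign_mul_eq_zero (Y : Equiv.Perm ι → ℝ) {x y : ι} (h : x ≠ y)
    (hY : ∀ σ, Y (σ * Equiv.swap x y) = Y σ) :
    ∑ σ : Equiv.Perm ι, ((Equiv.Perm.sign σ : ℤ) : ℝ) * Y σ = 0 := by
  have := sum_sign_mul_swap Y h
  simp only [hY] at this
  linarith

end Antisymmetrization

section Pairs

variable {n : ℕ}

/-- The first index of the `i`-th pair. -/
def fstIdx (i : Fin n) : Fin (2 * n + 1) := ⟨2 * (i : ℕ) + 1, by omega⟩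

/-- The second index of the `i`-th pair. -/
def sndIdx (i : Fin n) : Fin (2 * n + 1) := ⟨2 * (i : ℕ) + 2, by omega⟩

theorem fstIdx_ne_zero (i : Fin n) : fstIdx i ≠ 0 := by simp [fstIdx, Fin.ext_iff]

theorem sndIdx_ne_zero (i : Fin n) : sndIdx i ≠ 0 := by simp [sndIdx, Fin.ext_iff]

theorem fstIdx_ne_sndIdx (i j : Fin n) : fstIdx i ≠ sndIdx j := by
  simp only [fstIdx, sndIdx, ne_eq, Fin.ext_iff]
  omega

theorem fstIdx_ne {i j : Fin n} (h : i ≠ j) : fstIdx i ≠ fstIdx j := by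
  simp only [fstIdx, ne_eq, Fin.ext_iff] at h ⊢
  omega

theorem sndIdx_ne {i j : Fin n} (h : i ≠ j) : sndIdx i ≠ sndIdx j := by
  simp only [sndIdx, ne_eq, Fin.ext_iff] at h ⊢
  omega

end Pairs

section Stokes

variable {V : Type} [NormedAddCommGroup V] [NormedSpace ℝ V]

/-- The antisymmetrization of `w ⊗ c ⊗ ⋯ ⊗ c` over the vectors `e`, where `c` is the antisymmetric
part of `J`. -/
def curlVolume {n : ℕ} (w : Fin (2 * n + 1) → ℝ) (e : Fin (2 * n + 1) → V)
    (J : V →L[ℝ] V →L[ℝ] ℝ) : ℝ :=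
  ∑ σ : Equiv.Perm (Fin (2 * n + 1)), ((Equiv.Perm.sign σ : ℤ) : ℝ) * (w (σ 0) *
    ∏ i : Fin n, (J (e (σ (fstIdx i))) (e (σ (sndIdx i))) -
      J (e (σ (sndIdx i))) (e (σ (fstIdx i)))))

theorem continuous_curlVolume {n : ℕ} (w : Fin (2 * n + 1) → ℝ) (e : Fin (2 * n + 1) → V) :
    Continuous (curlVolume w e) := by
  unfold curlVolume
  fun_prop

/-- A primitive of the terms of `curlVolume`, in the direction `e (σ 1)`. -/
def curlPrimitive {n : ℕ} (i₀ : Fin n) (e : Fin (2 * n + 1) → V) (T : V → V →L[ℝ] ℝ)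
    (σ : Equiv.Perm (Fin (2 * n + 1))) (x : V) : ℝ :=
  T x (e (σ (sndIdx i₀))) * ∏ i ∈ Finset.univ.erase i₀,
    curl T x (e (σ (fstIdx i))) (e (σ (sndIdx i)))

theorem contDiff_curl {T : V → V →L[ℝ] ℝ} (hT : ContDiff ℝ 2 T) (u v : V) :
    ContDiff ℝ 1 fun x => curl T x u v := by
  have h : ContDiff ℝ 1 (fderiv ℝ T) := hT.fderiv_right (m := 1) (by norm_num)
  unfold curl
  fun_prop

theorem contDiff_curlPrimitive {n : ℕ} (i₀ : Fin n) (e : Fin (2 * n + 1) → V)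
    {T : V → V →L[ℝ] ℝ} (hT : ContDiff ℝ 2 T) (σ : Equiv.Perm (Fin (2 * n + 1))) :
    ContDiff ℝ 1 (curlPrimitive i₀ e T σ) :=
  ((hT.of_le one_le_two).clm_apply contDiff_const).mul
    (contDiff_prod fun _ _ => contDiff_curl hT _ _)

theorem hasFDerivAt_curl {T : V → V →L[ℝ] ℝ} (hT : ContDiff ℝ 2 T) (x u v : V) :
    HasFDerivAt (fun x => curl T x u v)
      ((((fderiv ℝ (fderiv ℝ T) x).flip u).flip v) - (((fderiv ℝ (fderiv ℝ T) x).flip v).flip u))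
      x := by
  have h : HasFDerivAt (fderiv ℝ T) (fderiv ℝ (fderiv ℝ T) x) x :=
    ((hT.fderiv_right (m := 1) (by norm_num)).differentiable one_ne_zero x).hasFDerivAt
  have h1 : ∀ u v : V, HasFDerivAt (fun x => fderiv ℝ T x u v)
      ((((fderiv ℝ (fderiv ℝ T) x).flip u).flip v)) x := fun u v => by
    refine ((h.clm_apply (hasFDerivAt_const u x)).clm_apply (hasFDerivAt_const v x)).congr_fderiv ?_
    ext z
    simp
  exact (h1 u v).sub (h1 v u)

theorem fderiv_fderiv_symm {T : V → V →L[ℝ] ℝ} (hT : ContDiff ℝ 2 T) (x u v : V) :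
    fderiv ℝ (fderiv ℝ T) x u v = fderiv ℝ (fderiv ℝ T) x v u := by
  refine second_derivative_symmetric_of_eventually (f := T) (f' := fderiv ℝ T) (x := x)
    (Eventually.of_forall fun y => (hT.differentiable two_ne_zero y).hasFDerivAt) ?_ u v
  exact ((hT.fderiv_right (m := 1) (by norm_num)).differentiable one_ne_zero x).hasFDerivAt

/-- The identity `(dθ)ⁿ = d(θ ∧ (dθ)ⁿ⁻¹)` in coordinates, with the pair `i₀` carrying the primitive.
The remaining factors contribute nothing since `d(dθ) = 0`. -/
theorem curlVolume_eq_sum_fderiv {n : ℕ} (i₀ : Fin n) (w : Fin (2 * n + 1) → ℝ)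
    (e : Fin (2 * n + 1) → V) {T : V → V →L[ℝ] ℝ} (hT : ContDiff ℝ 2 T) (x : V) :
    curlVolume w e (fderiv ℝ T x) = 2 * ∑ σ : Equiv.Perm (Fin (2 * n + 1)),
      ((Equiv.Perm.sign σ : ℤ) : ℝ) * (w (σ 0) *
        fderiv ℝ (curlPrimitive i₀ e T σ) x (e (σ (fstIdx i₀)))) := by
  set H := fderiv ℝ (fderiv ℝ T) x with hH
  set J := fderiv ℝ T x with hJ
  set c : Equiv.Perm (Fin (2 * n + 1)) → Fin n → ℝ := fun σ i =>
    curl T x (e (σ (fstIdx i))) (e (σ (sndIdx i))) with hc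
  -- the derivative of the primitive
  have hd : ∀ σ : Equiv.Perm (Fin (2 * n + 1)),
      fderiv ℝ (curlPrimitive i₀ e T σ) x (e (σ (fstIdx i₀))) =
        J (e (σ (fstIdx i₀))) (e (σ (sndIdx i₀))) * (∏ i ∈ Finset.univ.erase i₀, c σ i) +
        ∑ i ∈ Finset.univ.erase i₀, T x (e (σ (sndIdx i₀))) *
          ((∏ j ∈ (Finset.univ.erase i₀).erase i, c σ j) *
          (H (e (σ (fstIdx i₀))) (e (σ (fstIdx i))) (e (σ (sndIdx i))) -
            H (e (σ (fstIdx i₀))) (e (σ (sndIdx i))) (e (σ (fstIdx i))))) := by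
    intro σ
    have h1 : HasFDerivAt (fun x => T x (e (σ (sndIdx i₀)))) (J.flip (e (σ (sndIdx i₀)))) x := by
      refine (((hT.differentiable two_ne_zero x).hasFDerivAt).clm_apply
        (hasFDerivAt_const (e (σ (sndIdx i₀))) x)).congr_fderiv ?_
      ext z
      simp [hJ]
    have h2 := HasFDerivAt.finsetProd (u := Finset.univ.erase i₀)
      (g := fun i x => curl T x (e (σ (fstIdx i))) (e (σ (sndIdx i)))) (x := x)
      fun i _ => hasFDerivAt_curl hT x (e (σ (fstIdx i))) (e (σ (sndIdx i)))
    have h3 := (h1.mul h2).fderiv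
    have h4 := congrArg (fun L : V →L[ℝ] ℝ => L (e (σ (fstIdx i₀)))) h3
    refine Eq.trans h4 ?_
    simp only [add_apply, smul_apply, smul_eq_mul, sum_apply, sub_apply,
      ContinuousLinearMap.flip_apply, Finset.mul_sum]
    rw [add_comm, mul_comm]
  -- second-order terms cancel by symmetry
  have hzero : ∀ i ∈ Finset.univ.erase i₀, ∑ σ : Equiv.Perm (Fin (2 * n + 1)),
      ((Equiv.Perm.sign σ : ℤ) : ℝ) * (w (σ 0) * (T x (e (σ (sndIdx i₀))) *
          ((∏ j ∈ (Finset.univ.erase i₀).erase i, c σ j) *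
          (H (e (σ (fstIdx i₀))) (e (σ (fstIdx i))) (e (σ (sndIdx i))) -
            H (e (σ (fstIdx i₀))) (e (σ (sndIdx i))) (e (σ (fstIdx i))))))) = 0 := by
    intro i hi
    have hi₀ : i ≠ i₀ := Finset.ne_of_mem_erase hi
    -- Each half of the difference is invariant under exchanging the first two arguments of `H`,
    -- hence is killed by the sign.
    have hA := sum_sign_mul_eq_zero (fun σ : Equiv.Perm (Fin (2 * n + 1)) =>
      w (σ 0) * (T x (e (σ (sndIdx i₀))) * ((∏ j ∈ (Finset.univ.erase i₀).erase i, c σ j) *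
          H (e (σ (fstIdx i₀))) (e (σ (fstIdx i))) (e (σ (sndIdx i))))))
      (fstIdx_ne hi₀.symm) fun σ => by
        have hp : ∏ j ∈ (Finset.univ.erase i₀).erase i, c (σ * Equiv.swap (fstIdx i₀) (fstIdx i)) j =
            ∏ j ∈ (Finset.univ.erase i₀).erase i, c σ j := by
          refine Finset.prod_congr rfl fun j hj => ?_
          have hj1 := Finset.ne_of_mem_erase hj
          have hj2 := Finset.ne_of_mem_erase (Finset.mem_of_mem_erase hj)
          simp only [hc, Equiv.Perm.mul_apply]
          rw [Equiv.swap_apply_of_ne_of_ne (fstIdx_ne hj2) (fstIdx_ne hj1),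
            Equiv.swap_apply_of_ne_of_ne (fstIdx_ne_sndIdx _ _).symm (fstIdx_ne_sndIdx _ _).symm]
        simp only [hp, Equiv.Perm.mul_apply, Equiv.swap_apply_left, Equiv.swap_apply_right]
        rw [Equiv.swap_apply_of_ne_of_ne (fstIdx_ne_zero _).symm (fstIdx_ne_zero _).symm,
          Equiv.swap_apply_of_ne_of_ne (fstIdx_ne_sndIdx _ _).symm (fstIdx_ne_sndIdx _ _).symm,
          Equiv.swap_apply_of_ne_of_ne (fstIdx_ne_sndIdx _ _).symm (fstIdx_ne_sndIdx _ _).symm,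
          hH, fderiv_fderiv_symm hT]
    have hB := sum_sign_mul_eq_zero (fun σ : Equiv.Perm (Fin (2 * n + 1)) =>
      w (σ 0) * (T x (e (σ (sndIdx i₀))) * ((∏ j ∈ (Finset.univ.erase i₀).erase i, c σ j) *
          H (e (σ (fstIdx i₀))) (e (σ (sndIdx i))) (e (σ (fstIdx i))))))
      (fstIdx_ne_sndIdx i₀ i) fun σ => by
        have hp : ∏ j ∈ (Finset.univ.erase i₀).erase i, c (σ * Equiv.swap (fstIdx i₀) (sndIdx i)) j =
            ∏ j ∈ (Finset.univ.erase i₀).erase i, c σ j := by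
          refine Finset.prod_congr rfl fun j hj => ?_
          have hj1 := Finset.ne_of_mem_erase hj
          have hj2 := Finset.ne_of_mem_erase (Finset.mem_of_mem_erase hj)
          simp only [hc, Equiv.Perm.mul_apply]
          rw [Equiv.swap_apply_of_ne_of_ne (fstIdx_ne hj2) (fstIdx_ne_sndIdx _ _),
            Equiv.swap_apply_of_ne_of_ne (fstIdx_ne_sndIdx _ _).symm (sndIdx_ne hj1)]
        simp only [hp, Equiv.Perm.mul_apply, Equiv.swap_apply_left, Equiv.swap_apply_right]
        rw [Equiv.swap_apply_of_ne_of_ne (fstIdx_ne_zero _).symm (sndIdx_ne_zero _).symm,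
          Equiv.swap_apply_of_ne_of_ne (fstIdx_ne_sndIdx _ _).symm (sndIdx_ne hi₀.symm),
          Equiv.swap_apply_of_ne_of_ne (fstIdx_ne hi₀) (fstIdx_ne_sndIdx _ _),
          hH, fderiv_fderiv_symm hT]
    rw [← sub_zero (0 : ℝ)]
    nth_rewrite 1 [← hA]
    rw [← hB, ← Finset.sum_sub_distrib]
    refine Finset.sum_congr rfl fun σ _ => ?_
    ring
  -- the first-order terms are halves of the volume
  have hswap := sum_sign_mul_swap (fun σ : Equiv.Perm (Fin (2 * n + 1)) =>
    w (σ 0) * (J (e (σ (fstIdx i₀))) (e (σ (sndIdx i₀))) * ∏ i ∈ Finset.univ.erase i₀, c σ i))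
    (fstIdx_ne_sndIdx i₀ i₀)
  have hswap' : ∀ σ : Equiv.Perm (Fin (2 * n + 1)),
      ∏ i ∈ Finset.univ.erase i₀, c (σ * Equiv.swap (fstIdx i₀) (sndIdx i₀)) i =
        ∏ i ∈ Finset.univ.erase i₀, c σ i := fun σ => by
    refine Finset.prod_congr rfl fun j hj => ?_
    have hj1 := Finset.ne_of_mem_erase hj
    simp only [hc, Equiv.Perm.mul_apply]
    rw [Equiv.swap_apply_of_ne_of_ne (fstIdx_ne hj1) (fstIdx_ne_sndIdx _ _),
      Equiv.swap_apply_of_ne_of_ne (fstIdx_ne_sndIdx _ _).symm (sndIdx_ne hj1)]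
  simp only [hswap', Equiv.Perm.mul_apply, Equiv.swap_apply_left, Equiv.swap_apply_right,
    Equiv.swap_apply_of_ne_of_ne (fstIdx_ne_zero i₀).symm (sndIdx_ne_zero i₀).symm] at hswap
  have hR : ∑ σ : Equiv.Perm (Fin (2 * n + 1)), ((Equiv.Perm.sign σ : ℤ) : ℝ) * (w (σ 0) *
        fderiv ℝ (curlPrimitive i₀ e T σ) x (e (σ (fstIdx i₀)))) =
      ∑ σ : Equiv.Perm (Fin (2 * n + 1)), ((Equiv.Perm.sign σ : ℤ) : ℝ) * (w (σ 0) *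
        (J (e (σ (fstIdx i₀))) (e (σ (sndIdx i₀))) * ∏ i ∈ Finset.univ.erase i₀, c σ i)) := by
    simp only [hd, mul_add, Finset.sum_add_distrib, Finset.mul_sum]
    rw [Finset.sum_comm (s := Finset.univ), Finset.sum_eq_zero hzero, add_zero]
  have hL : curlVolume w e J =
      ∑ σ : Equiv.Perm (Fin (2 * n + 1)), ((Equiv.Perm.sign σ : ℤ) : ℝ) * (w (σ 0) *
        (J (e (σ (fstIdx i₀))) (e (σ (sndIdx i₀))) * ∏ i ∈ Finset.univ.erase i₀, c σ i)) -
      ∑ σ : Equiv.Perm (Fin (2 * n + 1)), ((Equiv.Perm.sign σ : ℤ) : ℝ) * (w (σ 0) *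
        (J (e (σ (sndIdx i₀))) (e (σ (fstIdx i₀))) * ∏ i ∈ Finset.univ.erase i₀, c σ i)) := by
    rw [curlVolume, ← Finset.sum_sub_distrib]
    refine Finset.sum_congr rfl fun σ _ => ?_
    rw [← Finset.mul_prod_erase _ _ (Finset.mem_univ i₀)]
    simp only [hc, curl, ← hJ]
    ring
  rw [hR, hL, hswap]
  ring

end Stokes

/-! ### Stokes on the torus for `C¹` forms -/

section Periodic

variable {m : ℕ}

/-- `q` factors through the projection onto the torus. -/
def IsTorusPeriodic {F : Type} (q : (Fin m → ℝ) → F) : Prop :=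
  ∀ x y, (FlatTorus.proj x : Torus m) = FlatTorus.proj y → q x = q y

theorem isOpenQuotientMap_proj :
    IsOpenQuotientMap (FlatTorus.proj : (Fin m → ℝ) → Torus m) := by
  have h : IsOpenQuotientMap (FlatTorus.proj : ℝ → UnitAddCircle) :=
    QuotientAddGroup.isOpenQuotientMap_mk
  exact IsOpenQuotientMap.piMap fun _ => h

theorem IsTorusPeriodic.apply_rep {F : Type} {q : (Fin m → ℝ) → F} (hq : IsTorusPeriodic q)
    (x : Fin m → ℝ) : q (FlatTorus.rep (FlatTorus.proj x : Torus m)) = q x :=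
  hq _ _ (FlatTorus.proj_rep _)

theorem IsTorusPeriodic.continuous_comp_rep {F : Type} [TopologicalSpace F] {q : (Fin m → ℝ) → F}
    (hq : IsTorusPeriodic q) (hc : Continuous q) :
    Continuous fun p : Torus m => q (FlatTorus.rep p) := by
  rw [isOpenQuotientMap_proj.isQuotientMap.continuous_iff]
  convert hc using 1
  funext x
  exact hq.apply_rep x

theorem IsTorusPeriodic.integrable {F : Type} [NormedAddCommGroup F] {q : (Fin m → ℝ) → F}
    (hq : IsTorusPeriodic q) (hc : Continuous q) :
    Integrable fun p : Torus m => q (FlatTorus.rep p) :=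
  (hq.continuous_comp_rep hc).integrable_of_hasCompactSupport (HasCompactSupport.of_compactSpace _)

theorem isTorusPeriodic_fderiv {F : Type} [NormedAddCommGroup F] [NormedSpace ℝ F]
    {q : (Fin m → ℝ) → F} (hq : IsTorusPeriodic q) : IsTorusPeriodic (fderiv ℝ q) := by
  intro x y hxy
  have : (fun h => q (x + h)) = fun h => q (y + h) := by
    funext h
    exact hq _ _ (by rw [map_add, map_add, hxy])
  have h2 := congrArg (fun g => fderiv ℝ g 0) this
  simpa only [fderiv_comp_add_left, add_zero] using h2

theorem IsTorusPeriodic.exists_norm_le {F : Type} [NormedAddCommGroup F] {q : (Fin m → ℝ) → F}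
    (hq : IsTorusPeriodic q) (hc : Continuous q) : ∃ K : ℝ, 0 < K ∧ ∀ x, ‖q x‖ ≤ K := by
  have : Continuous fun x : Fin m → ℝ => q (FlatTorus.rep (FlatTorus.proj x : Torus m)) := by
    convert hc using 1
    funext x
    exact hq.apply_rep x
  obtain ⟨K, hK, h⟩ := exists_norm_le_of_continuous (M := Torus m)
    (q := fun p => q (FlatTorus.rep p)) this
  exact ⟨K, hK, fun x => by rw [← hq.apply_rep x]; exact h _⟩

/-- The integral of a derivative over the torus vanishes. -/
theorem IsTorusPeriodic.integral_fderiv {u : (Fin m → ℝ) → ℝ} (hu : IsTorusPeriodic u)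
    (hc : ContDiff ℝ 1 u) (a : Fin m → ℝ) :
    ∫ p : Torus m, fderiv ℝ u (FlatTorus.rep p) a = 0 := by
  have hf : Continuous (fderiv ℝ u) := hc.continuous_fderiv one_ne_zero
  obtain ⟨K, hK, hKb⟩ := (isTorusPeriodic_fderiv hu).exists_norm_le hf
  have hshift : ∀ s : ℝ, IsTorusPeriodic fun x => u (x + s • a) := fun s x y hxy =>
    hu _ _ (by rw [map_add, map_add, hxy])
  have hcs : ∀ s : ℝ, Continuous fun x => u (x + s • a) := fun s => by
    have := hc.continuous
    fun_prop
  -- Translation invariance of Haar measure; differentiating in `s` at `0` gives the result.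
  have hconst : ∀ s : ℝ, ∫ p : Torus m, u (FlatTorus.rep p + s • a) =
      ∫ p : Torus m, u (FlatTorus.rep p) := fun s => by
    rw [← integral_add_right_eq_self (fun p : Torus m => u (FlatTorus.rep p))
      (FlatTorus.proj (s • a))]
    congr 1
    funext p
    refine hu _ _ ?_
    rw [map_add, FlatTorus.proj_rep, FlatTorus.proj_rep]
  have hper : IsTorusPeriodic fun x => fderiv ℝ u x a := fun x y hxy => by
    simp only [isTorusPeriodic_fderiv hu x y hxy]
  have hder := hasDerivAt_integral_of_dominated_loc_of_deriv_le (μ := (volume : Measure (Torus m)))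
    (F := fun s p => u (FlatTorus.rep p + s • a))
    (F' := fun s p => fderiv ℝ u (FlatTorus.rep p + s • a) a) (x₀ := (0 : ℝ))
    (s := Set.univ) (bound := fun _ => K * ‖a‖) univ_mem
    (Eventually.of_forall fun s => ((hshift s).continuous_comp_rep (hcs s)).aestronglyMeasurable)
    ((hshift 0).integrable (hcs 0))
    (by
      simp only [zero_smul, add_zero]
      exact (hper.continuous_comp_rep (by fun_prop)).aestronglyMeasurable)
    (Eventually.of_forall fun p s _ => ContinuousLinearMap.le_of_opNorm_le _ (hKb _) _)
    (integrable_const _)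
    (Eventually.of_forall fun p s _ => by
      have h1 : HasDerivAt (fun s : ℝ => FlatTorus.rep p + s • a) a s := by
        simpa using ((hasDerivAt_id s).smul_const a).const_add (FlatTorus.rep p)
      exact ((hc.differentiable one_ne_zero _).hasFDerivAt).comp_hasDerivAt s h1)
  have h0 := hder.2
  simp only [hconst, zero_smul, add_zero] at h0
  exact h0.unique (hasDerivAt_const _ _)

theorem integral_curlVolume_of_contDiff_two {n : ℕ} (i₀ : Fin n) (w : Fin (2 * n + 1) → ℝ)
    (e : Fin (2 * n + 1) → Fin m → ℝ) {T : (Fin m → ℝ) → (Fin m → ℝ) →L[ℝ] ℝ}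
    (hT : ContDiff ℝ 2 T) (hper : IsTorusPeriodic T) :
    ∫ p : Torus m, curlVolume w e (fderiv ℝ T (FlatTorus.rep p)) = 0 := by
  simp only [curlVolume_eq_sum_fderiv i₀ w e hT]
  have hp : ∀ σ, IsTorusPeriodic (curlPrimitive i₀ e T σ) := fun σ x y hxy => by
    simp only [curlPrimitive, curl, hper x y hxy, isTorusPeriodic_fderiv hper x y hxy]
  have hc := contDiff_curlPrimitive i₀ e hT
  rw [integral_const_mul, integral_finsetSum]
  · have h0 := fun σ => IsTorusPeriodic.integral_fderiv (hp σ) (hc σ) (e (σ (fstIdx i₀)))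
    simp only [integral_const_mul, h0, mul_zero, Finset.sum_const_zero]
  · intro σ _
    refine ((IsTorusPeriodic.integrable
      (q := fun x => fderiv ℝ (curlPrimitive i₀ e T σ) x (e (σ (fstIdx i₀)))) ?_ ?_).const_mul
        _).const_mul _
    · intro x y hxy
      simp only [isTorusPeriodic_fderiv (hp σ) x y hxy]
    · exact ((hc σ).continuous_fderiv one_ne_zero).clm_apply continuous_const

open scoped Convolution in
/-- Mollification of a periodic `C¹` map: smooth approximations whose derivatives are bounded and
converge pointwise. -/
theorem IsTorusPeriodic.exists_smooth_approx {F : Type} [NormedAddCommGroup F] [NormedSpace ℝ F]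
    [CompleteSpace F] {T : (Fin m → ℝ) → F} (hT : ContDiff ℝ 1 T) (hper : IsTorusPeriodic T) :
    ∃ (S : ℕ → (Fin m → ℝ) → F) (K : ℝ), (∀ k, ContDiff ℝ ∞ (S k)) ∧
      (∀ k, IsTorusPeriodic (S k)) ∧ (∀ k x, ‖fderiv ℝ (S k) x‖ ≤ K) ∧
      ∀ x, Tendsto (fun k => fderiv ℝ (S k) x) atTop (𝓝 (fderiv ℝ T x)) := by
  let φ : ℕ → ContDiffBump (0 : Fin m → ℝ) := fun k =>
    ⟨1 / ((k : ℝ) + 1) / 2, 1 / ((k : ℝ) + 1), by positivity, half_lt_self (by positivity)⟩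
  have hφ : Tendsto (fun k => (φ k).rOut) atTop (𝓝 0) := tendsto_one_div_add_atTop_nhds_zero_nat
  let ρ : ℕ → (Fin m → ℝ) → ℝ := fun k => (φ k).normed volume
  let S : ℕ → (Fin m → ℝ) → F := fun k => ρ k ⋆[ContinuousLinearMap.lsmul ℝ ℝ, volume] T
  have hf : Continuous (fderiv ℝ T) := hT.continuous_fderiv one_ne_zero
  obtain ⟨K, hK, hKb⟩ := (isTorusPeriodic_fderiv hper).exists_norm_le hf
  have hρc : ∀ k, Continuous (ρ k) := fun k => (φ k).continuous_normed
  have hρs : ∀ k, HasCompactSupport (ρ k) := fun k => (φ k).hasCompactSupport_normed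
  have hint : ∀ k {G : Type} [NormedAddCommGroup G] [NormedSpace ℝ G] (g : (Fin m → ℝ) → G)
      (x : Fin m → ℝ), Continuous g → Integrable fun t => ρ k t • g (x - t) := fun k G _ _ g x hg =>
    ((hρc k).smul (hg.comp (by fun_prop))).integrable_of_hasCompactSupport ((hρs k).smul_right)
  have hbound : ∀ k x t, ‖ρ k t • fderiv ℝ T (x - t)‖ ≤ ρ k t * K := fun k x t => by
    rw [norm_smul, Real.norm_of_nonneg ((φ k).nonneg_normed t)]
    exact mul_le_mul_of_nonneg_left (hKb _) ((φ k).nonneg_normed t)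
  have hρint : ∀ k, Integrable fun t => ρ k t * K := fun k =>
    ((hρc k).integrable_of_hasCompactSupport (hρs k)).mul_const K
  -- The derivative is put on `T`, not on the mollifier, so the bound `K` for `fderiv ℝ T` is
  -- inherited uniformly in `k`.
  have hder : ∀ k x, HasFDerivAt (S k) (∫ t, ρ k t • fderiv ℝ T (x - t)) x := fun k x =>
    hasFDerivAt_integral_of_dominated_of_fderiv_le (μ := (volume : Measure (Fin m → ℝ)))
      (F := fun x t => ρ k t • T (x - t)) (F' := fun x t => ρ k t • fderiv ℝ T (x - t))
      (s := Set.univ) (bound := fun t => ρ k t * K) univ_mem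
      (Eventually.of_forall fun y => (hint k T y hT.continuous).aestronglyMeasurable)
      (hint k T x hT.continuous) (hint k _ x hf).aestronglyMeasurable
      (Eventually.of_forall fun t y _ => hbound k y t) (hρint k)
      (Eventually.of_forall fun t y _ => by
        have h1 : HasFDerivAt (fun y => T (y - t)) (fderiv ℝ T (y - t)) y := by
          exact (((hT.differentiable one_ne_zero (y - t)).hasFDerivAt).comp y
            ((hasFDerivAt_id y).sub_const t)).congr_fderiv (ContinuousLinearMap.comp_id _)
        exact h1.const_smul (ρ k t))
  refine ⟨S, K, fun k => ?_, fun k x y hxy => ?_, fun k x => ?_, fun x => ?_⟩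
  · exact (hρs k).contDiff_convolution_left (n := ⊤) _ (φ k).contDiff_normed
      hT.continuous.locallyIntegrable
  · change ∫ t, ρ k t • T (x - t) = ∫ t, ρ k t • T (y - t)
    congr 1
    funext t
    rw [hper (x - t) (y - t) (by rw [map_sub, map_sub, hxy])]
  · rw [(hder k x).fderiv]
    refine (norm_integral_le_of_norm_le (hρint k) (Eventually.of_forall fun t => hbound k x t)).trans
      (le_of_eq ?_)
    rw [integral_mul_const, (φ k).integral_normed, one_mul]
  · have := ContDiffBump.convolution_tendsto_right_of_continuous (μ := volume) hφ hf x
    refine this.congr fun k => ?_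
    rw [(hder k x).fderiv]
    rfl

/-- Supplies the dominating constant for passing to the limit along the mollifications. -/
theorem exists_curlVolume_bound {V : Type} [NormedAddCommGroup V] [NormedSpace ℝ V] {n : ℕ}
    (w : Fin (2 * n + 1) → ℝ) (e : Fin (2 * n + 1) → V) (K : ℝ) :
    ∃ B : ℝ, ∀ J : V →L[ℝ] V →L[ℝ] ℝ, ‖J‖ ≤ K → ‖curlVolume w e J‖ ≤ B := by
  refine ⟨∑ σ : Equiv.Perm (Fin (2 * n + 1)), |w (σ 0)| * ∏ i : Fin n,
    (K * ‖e (σ (fstIdx i))‖ * ‖e (σ (sndIdx i))‖ + K * ‖e (σ (sndIdx i))‖ * ‖e (σ (fstIdx i))‖),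
    fun J hJ => ?_⟩
  have hJ2 : ∀ a b, |J a b| ≤ K * ‖a‖ * ‖b‖ := fun a b =>
    (J.le_opNorm₂ a b).trans (by gcongr)
  refine (norm_sum_le _ _).trans (Finset.sum_le_sum fun σ _ => ?_)
  rw [norm_mul, norm_mul, Real.norm_eq_abs, Real.norm_eq_abs]
  have hs : |((Equiv.Perm.sign σ : ℤ) : ℝ)| = 1 := by
    rcases Int.units_eq_one_or (Equiv.Perm.sign σ) with h | h <;> simp [h]
  rw [hs, one_mul, norm_prod]
  refine mul_le_mul_of_nonneg_left (Finset.prod_le_prod (fun _ _ => norm_nonneg _) fun i _ => ?_)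
    (abs_nonneg _)
  exact (abs_sub _ _).trans (add_le_add (hJ2 _ _) (hJ2 _ _))

/-- Stokes' theorem for the top power of an exact `2`-form on the torus. -/
theorem integral_curlVolume {n : ℕ} (i₀ : Fin n) (w : Fin (2 * n + 1) → ℝ)
    (e : Fin (2 * n + 1) → Fin m → ℝ) {T : (Fin m → ℝ) → (Fin m → ℝ) →L[ℝ] ℝ}
    (hT : ContDiff ℝ 1 T) (hper : IsTorusPeriodic T) :
    ∫ p : Torus m, curlVolume w e (fderiv ℝ T (FlatTorus.rep p)) = 0 := by
  obtain ⟨S, K, hS, hSper, hSK, hlim⟩ := hper.exists_smooth_approx hT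
  have hc := continuous_curlVolume w e
  obtain ⟨B, hB⟩ := exists_curlVolume_bound w e K
  have hmeas : ∀ k, AEStronglyMeasurable (fun p : Torus m =>
      curlVolume w e (fderiv ℝ (S k) (FlatTorus.rep p))) volume := fun k => by
    have h1 : Continuous fun p : Torus m => fderiv ℝ (S k) (FlatTorus.rep p) :=
      (isTorusPeriodic_fderiv (hSper k)).continuous_comp_rep ((hS k).continuous_fderiv (by simp))
    exact (hc.comp h1).aestronglyMeasurable
  have hle : ∀ k (p : Torus m), ‖curlVolume w e (fderiv ℝ (S k) (FlatTorus.rep p))‖ ≤ B :=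
    fun k p => hB _ (hSK k _)
  have hpt : ∀ p : Torus m, Tendsto (fun k => curlVolume w e (fderiv ℝ (S k) (FlatTorus.rep p)))
      atTop (𝓝 (curlVolume w e (fderiv ℝ T (FlatTorus.rep p)))) :=
    fun p => (hc.tendsto _).comp (hlim _)
  have hlimit := tendsto_integral_of_dominated_convergence (μ := (volume : Measure (Torus m)))
    (F := fun k p => curlVolume w e (fderiv ℝ (S k) (FlatTorus.rep p)))
    (f := fun p => curlVolume w e (fderiv ℝ T (FlatTorus.rep p))) (fun _ => B)
    hmeas (integrable_const _) (fun k => Eventually.of_forall (hle k)) (Eventually.of_forall hpt)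
  have hz : ∀ k, ∫ p : Torus m, curlVolume w e (fderiv ℝ (S k) (FlatTorus.rep p)) = 0 := fun k =>
    integral_curlVolume_of_contDiff_two i₀ w e (contDiff_infty.1 (hS k) 2) (hSper k)
  simp only [hz] at hlimit
  exact tendsto_nhds_unique hlimit tendsto_const_nhds

/-- The top power of an exact `2`-form on the torus vanishes somewhere. -/
theorem exists_curlVolume_eq_zero {n : ℕ} (i₀ : Fin n) (w : Fin (2 * n + 1) → ℝ)
    (e : Fin (2 * n + 1) → Fin m → ℝ) {T : (Fin m → ℝ) → (Fin m → ℝ) →L[ℝ] ℝ}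
    (hT : ContDiff ℝ 1 T) (hper : IsTorusPeriodic T) :
    ∃ x, curlVolume w e (fderiv ℝ T x) = 0 := by
  by_contra! hne
  have hq : Continuous fun x => curlVolume w e (fderiv ℝ T x) :=
    (continuous_curlVolume w e).comp (hT.continuous_fderiv one_ne_zero)
  have hqp : IsTorusPeriodic fun x => curlVolume w e (fderiv ℝ T x) := fun x y hxy => by
    simp only [isTorusPeriodic_fderiv hper x y hxy]
  have hint := integral_curlVolume i₀ w e hT hper
  have hcont := hqp.continuous_comp_rep hq
  have hpos : ∀ q : (Fin m → ℝ) → ℝ, Continuous (fun p : Torus m => q (FlatTorus.rep p)) →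
      (∀ x, 0 < q x) → ∫ p : Torus m, q (FlatTorus.rep p) ≠ 0 := fun q hq h0 => by
    refine (integral_pos_of_integrable_nonneg_nonzero (x := 0) hq
      (hq.integrable_of_hasCompactSupport (HasCompactSupport.of_compactSpace _))
      (fun p => (h0 _).le) (h0 _).ne').ne'
  -- A continuous function without zeros on a connected space has constant sign.
  have hsign : (∀ x, 0 < curlVolume w e (fderiv ℝ T x)) ∨
      ∀ x, 0 < -curlVolume w e (fderiv ℝ T x) := by
    by_contra! h
    obtain ⟨⟨x, hx⟩, y, hy⟩ := h
    obtain ⟨z, hz⟩ := mem_range_of_exists_le_of_exists_ge hq ⟨x, hx⟩ ⟨y, by linarith⟩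
    exact hne z hz
  rcases hsign with h | h
  · exact hpos _ hcont h hint
  · refine hpos (fun x => -curlVolume w e (fderiv ℝ T x)) hcont.neg h ?_
    rw [integral_neg, hint, neg_zero]

end Periodic

/-! ### No rotation-invariant contact structure transverse to the circles -/

/-- On vectors the first of which is vertical, the form `(dt + θ) ∧ (dθ)ⁿ` is `dt ∧ (dθ)ⁿ`. -/
theorem topForm_eq_curlVolume {V : Type} [NormedAddCommGroup V] [NormedSpace ℝ V] {n : ℕ}
    (T : V → V →L[ℝ] ℝ) (x : V)
    {b : Fin (2 * n + 1) → V × ℝ} (hb0 : b 0 = (0, 1)) :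
    topForm n (LinearMap.snd ℝ V ℝ + (T x : V →ₗ[ℝ] ℝ) ∘ₗ LinearMap.fst ℝ V ℝ)
      ((curlForm T x).compl₁₂ (LinearMap.fst ℝ V ℝ) (LinearMap.fst ℝ V ℝ)) b =
      curlVolume (fun i => (b i).2) (fun i => (b i).1) (fderiv ℝ T x) := by
  rw [topForm_apply, curlVolume]
  refine Finset.sum_congr rfl fun σ _ => ?_
  congr 1
  set P := ∏ i : Fin n, (fderiv ℝ T x (b (σ (fstIdx i))).1 (b (σ (sndIdx i))).1 -
    fderiv ℝ T x (b (σ (sndIdx i))).1 (b (σ (fstIdx i))).1) with hP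
  change ((b (σ 0)).2 + T x (b (σ 0)).1) * P = (b (σ 0)).2 * P
  by_cases hσ : σ 0 = 0
  · rw [hσ, hb0]
    simp
  obtain ⟨j, hj⟩ := σ.surjective 0
  have hj0 : (j : ℕ) ≠ 0 := fun h => hσ (by
    rwa [show j = 0 from Fin.ext h] at hj)
  have hjn : (j : ℕ) < 2 * n + 1 := j.2
  -- The vertical vector now sits at index `j > 0`, in the pair `(j - 1) / 2`; its base component is
  -- zero, so that factor vanishes.
  have hP0 : P = 0 := by
    refine Finset.prod_eq_zero (Finset.mem_univ (⟨((j : ℕ) - 1) / 2, by omega⟩ : Fin n)) ?_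
    rcases Nat.even_or_odd' (j : ℕ) with ⟨k, hk | hk⟩
    · have : sndIdx (⟨((j : ℕ) - 1) / 2, by omega⟩ : Fin n) = j := by
        simp only [sndIdx, Fin.ext_iff]
        omega
      simp [this, hj, hb0]
    · have : fstIdx (⟨((j : ℕ) - 1) / 2, by omega⟩ : Fin n) = j := by
        simp only [fstIdx, Fin.ext_iff]
        omega
      simp [this, hj, hb0]
  rw [hP0, mul_zero, mul_zero]

theorem curl_apply_of_hasFDerivAt {E : Type} [NormedAddCommGroup E] [NormedSpace ℝ E]
    {A : E → E →L[ℝ] ℝ} {y u v : E} (hA : DifferentiableAt ℝ A y) {Lu Lv : E →L[ℝ] ℝ}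
    (hu : HasFDerivAt (fun x => A x u) Lu y) (hv : HasFDerivAt (fun x => A x v) Lv y) :
    curl A y u v = Lv u - Lu v := by
  have h : ∀ w : E, HasFDerivAt (fun x => A x w) ((fderiv ℝ A y).flip w) y := fun w => by
    refine (hA.hasFDerivAt.clm_apply (hasFDerivAt_const w y)).congr_fderiv ?_
    ext z
    simp
  rw [hu.unique (h u), hv.unique (h v)]
  rfl

/-- There is no contact form on `𝕋ᵐ × 𝕊¹` which is transverse to the circles and whose kernel is
invariant under the rotations of the circles. -/
theorem not_isContactForm_of_fiberSlope_const {n : ℕ} (hn : 1 ≤ n)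
    {α : Torus (2 * n) × UnitAddCircle → ((Fin (2 * n) → ℝ) × ℝ) [⋀^Fin 1]→L[ℝ] ℝ}
    (hvert : ∀ z, vertical α z ≠ 0)
    (hslope : ∀ p t t', fiberSlope α (p, t) = fiberSlope α (p, t')) : ¬ IsContactForm n α := by
  intro hα
  have hE : Module.finrank ℝ ((Fin (2 * n) → ℝ) × ℝ) = 2 * n + 1 := by
    rw [Module.finrank_prod, Module.finrank_fin_fun, Module.finrank_self]
  obtain ⟨b, hb0, -⟩ := exists_basis_ker hE (a := LinearMap.snd ℝ (Fin (2 * n) → ℝ) ℝ)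
    (x := (0, 1)) (by simp)
  let T : (Fin (2 * n) → ℝ) → (Fin (2 * n) → ℝ) →L[ℝ] ℝ := fun x =>
    fiberSlope α (FlatTorus.proj x, 0)
  have hT : ContDiff ℝ 1 T := by
    have h1 : T = (fun y : (Fin (2 * n) → ℝ) × ℝ => fiberSlope α (FlatTorus.proj y)) ∘
        fun x => (x, 0) := by
      funext x
      change fiberSlope α (_, 0) = fiberSlope α (FlatTorus.proj x, FlatTorus.proj 0)
      rw [map_zero]
    rw [h1]
    exact (contDiff_fiberSlope hα.1 hvert).comp (by fun_prop)
  have hper : IsTorusPeriodic T := fun x y hxy => by simp only [T, hxy]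
  -- Here `n ≥ 1` enters: a pair is needed to carry the primitive. For `n = 0` the form would be
  -- `dt`, which has no zeros.
  obtain ⟨x, hx⟩ := exists_curlVolume_eq_zero ⟨0, hn⟩ (fun i => (b i).2) (fun i => (b i).1) hT hper
  rw [← topForm_eq_curlVolume T x hb0] at hx
  let y₀ : (Fin (2 * n) → ℝ) × ℝ := (x, 0)
  let A : (Fin (2 * n) → ℝ) × ℝ → (Fin (2 * n) → ℝ) × ℝ →L[ℝ] ℝ := fun y =>
    covector α (FlatTorus.proj y)
  let φ : (Fin (2 * n) → ℝ) × ℝ → ℝ := fun y => vertical α (FlatTorus.proj y)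
  have hA : ∀ y v, A y v = φ y * (v.2 + T y.1 v.1) := fun y v => by
    have h0 := hvert (FlatTorus.proj y)
    have h1 : T y.1 = fiberSlope α (FlatTorus.proj y) := hslope _ _ _
    rw [h1]
    change covector α (FlatTorus.proj y) (v.1, v.2) = vertical α (FlatTorus.proj y) * _
    rw [covector_split, fiberSlope, smul_apply, ContinuousLinearMap.comp_apply,
      ContinuousLinearMap.inl_apply, smul_eq_mul]
    field_simp
    ring
  have hφ : HasFDerivAt φ (fderiv ℝ φ y₀) y₀ :=
    ((contDiff_vertical hα.1).differentiable one_ne_zero y₀).hasFDerivAt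
  have hTd : ∀ v : Fin (2 * n) → ℝ, HasFDerivAt (fun y : (Fin (2 * n) → ℝ) × ℝ => T y.1 v)
      (((fderiv ℝ T x).flip v).comp (ContinuousLinearMap.fst ℝ _ ℝ)) y₀ := fun v => by
    have h1 : HasFDerivAt (fun y => T y v) ((fderiv ℝ T x).flip v) y₀.1 := by
      refine ((hT.differentiable one_ne_zero x).hasFDerivAt.clm_apply
        (hasFDerivAt_const v x)).congr_fderiv ?_
      ext z
      simp
    exact h1.comp y₀ hasFDerivAt_fst
  have hAd : ∀ v, HasFDerivAt (fun y => A y v) (φ y₀ • ((fderiv ℝ T x).flip v.1).comp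
      (ContinuousLinearMap.fst ℝ _ ℝ) + (v.2 + T x v.1) • fderiv ℝ φ y₀) y₀ := fun v => by
    simp only [hA]
    exact hφ.mul ((hTd v.1).const_add v.2)
  -- This is `dα = φ dθ + dφ ∧ (dt + θ)`; the last term dies on `ker (dt + θ)`, so
  -- `topForm_eq_of_ker` applies with `c = φ y₀`.
  have hcurl : ∀ u v, curl A y₀ u v = φ y₀ * curl T x u.1 v.1 +
      ((v.2 + T x v.1) * fderiv ℝ φ y₀ u - (u.2 + T x u.1) * fderiv ℝ φ y₀ v) := fun u v => by
    rw [curl_apply_of_hasFDerivAt ((contDiff_covector hα.1).differentiable one_ne_zero y₀)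
      (hAd u) (hAd v), curl]
    simp
    ring
  refine topForm_basis_ne_zero b _ _ ?_ (hx : topForm n _ _ b = 0)
  obtain ⟨v, hv⟩ := hα.2 (FlatTorus.proj y₀)
  refine ⟨v, fun h0 => hv ?_⟩
  rw [contactVolume_eq_topForm hα.1]
  rw [topForm_eq_of_ker hE (c := φ y₀) ?_ ?_ v, h0, mul_zero]
  · exact LinearMap.ext fun u => hA y₀ u
  · intro u w hu hw
    have h1 : curlForm (fun y : (Fin (2 * n) → ℝ) × ℝ =>
        covector α (FlatTorus.proj y₀ + FlatTorus.proj y)) 0 u w = curl A y₀ u w := by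
      simp only [curlForm_apply, ← map_add]
      exact curl_add_left A y₀ u w
    have hu' : u.2 + T x u.1 = 0 := hu
    have hw' : w.2 + T x w.1 = 0 := hw
    rw [h1, hcurl, hu', hw']
    simp [curlForm_apply]

end

/-- Already the contact property fails: neither partial hyperbolicity nor the transfer map is
needed. -/
theorem theoremA (n : ℕ) (hn : 1 ≤ n) (r : WithTop ℕ∞) (hr : 1 ≤ r)
    (f : Torus (2 * n) ≃ Torus (2 * n)) (hf : IsDiffeo r f)
    (hAnosov : IsAnosov f) (hSymplectic : IsSymplecticMap f)
    (γ : Torus (2 * n) → UnitAddCircle) (hγ : IsCr r γ) (hcob : IsCoboundary f γ) :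
    ¬ (IsPartiallyHyperbolic (skewProduct f γ) ∧ IsContactDiffeo n (skewProduct f γ)) := by
  rintro ⟨-, α, τ, hα, hτ0, hτ⟩
  obtain ⟨hvert, hslope⟩ := vertical_ne_zero_and_fiberSlope_const (Module.finrank_fin_fun ℝ)
    (hf.1.of_le hr) (hf.2.of_le hr) hAnosov hSymplectic (hγ.of_le hr) hα hτ0 hτ
  exact not_isContactForm_of_fiberSlope_const hn hvert hslope hα
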